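/- For $0<\alpha<1$ and a function $f:(0,\infty)\to\mathbb R$ that is continuously differentiable on $(0,\infty)$, let $D^{\alpha}f(t)=\frac{1}{\Gamma(1-\alpha)}\int_0^t (t-\tau)^{-\alpha}f'(\tau)\,d\tau$, $t>0$, be its Caputo derivative of order $\alpha$ (the integral is required to converge absolutely), let $\mathscr D^{\beta}=D^{\beta}$ and $\mathscr D^{2\beta}=D^{\beta}D^{\beta}$ be the sequential derivatives, and let $E_\beta(z)=\sum_{k\ge 0} z^k/\Gamma(k\beta+1)$ be the Mittag-Leffler function. The value $\mathscr D^{\beta}u(0)$ means $\lim_{t\to 0+}D^{\beta}u(t)$. Let $0<\beta<\frac12$, $\mu>0$ and $0<\gamma<\mu^2$, and put $$r_1=-\mu+\sqrt{\mu^2-\gamma},\quad r_2=-\mu-\sqrt{\mu^2-\gamma},\quad c_1=\tfrac12\Big(1+\tfrac{\mu}{\sqrt{\mu^2-\gamma}}\Big),\quad c_2=\tfrac12\Big(1-\tfrac{\mu}{\sqrt{\mu^2-\gamma}}\Big).$$ Then $r_1<0$ and $r_2<0$. The initial value problem $$D^{2\beta}u(t)+2\mu D^{\beta}u(t)+\gamma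 u(t)=0\quad(t>0),\qquad u(0)=1,$$ and the sequential problem $$\mathscr D^{2\beta}u(t)+2\mu \mathscr D^{\beta}u(t)+\gamma u(t)=0\quad(t>0),\qquad u(0)=1,\quad \mathscr D^{\beta}u(0)=0,$$ each have exactly one solution $u$ continuous on $[0,\infty)$, namely $$u(t)=c_1E_\beta(r_1t^\beta)+c_2E_\beta(r_2t^\beta),\qquad t\ge 0.$$ This solution is nonzero for all large $t$, and $$\beta=-\lim_{t\to\infty}\frac{t\,u'(t)}{u(t)}.$$ Moreover, $\mathscr D^{2\beta}u=D^{2\beta}u$ on $(0,\infty)$ for the solution $u$ of the sequential problem; and whenever a function $a_1E_\beta(r_1t^\beta)+a_2E_\beta(r_2t^\beta)$ with $a_1,a_2\in\mathbb R$ solves the sequential equation with $u(0)=1$ and $\mathscr D^{\beta}u(0)=b$, one has $a_1r_1+a_2r_2=b$. -/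

import Mathlib

open Set Filter Topology MeasureTheory

noncomputable section

/-- The one-parameter Mittag-Leffler function `E_α(z) = ∑ z ^ k / Γ(k α + 1)` of a real argument
(the series converges for every `z` when `α > 0`). -/
def mittagLeffler (α z : ℝ) : ℝ :=
  ∑' k : ℕ, z ^ k / Real.Gamma (k * α + 1)

/-- The Caputo derivative, with lower terminal `0`, of (non-integer) order `α > 0` at the point
`t > 0`. Here `⌈α⌉₊` is the natural number `n` with `n - 1 < α < n`. -/
def caputoDeriv (α : ℝ) (f : ℝ → ℝ) (t : ℝ) : ℝ :=
  1 / Real.Gamma (⌈α⌉₊ - α) *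
    ∫ τ in (0 : ℝ)..t, (t - τ) ^ ((⌈α⌉₊ : ℝ) - α - 1) * iteratedDeriv ⌈α⌉₊ f τ

/-- `f` has a Caputo derivative of order `α` on `(0, ∞)`: with `n - 1 < α < n`, the function `f` has
`n` continuous derivatives on `(0, ∞)`, and the integral that defines the Caputo derivative
converges at every `t > 0`. -/
structure CaputoDifferentiable (α : ℝ) (f : ℝ → ℝ) : Prop where
  contDiffOn : ContDiffOn ℝ ⌈α⌉₊ f (Ioi 0)
  intervalIntegrable : ∀ t : ℝ, 0 < t → IntervalIntegrable
    (fun τ => (t - τ) ^ ((⌈α⌉₊ : ℝ) - α - 1) * iteratedDeriv ⌈α⌉₊ f τ) volume 0 t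

/-- The sequential Caputo derivative `𝒟^{nβ} = D^β D^β ⋯ D^β` (`n` factors). -/
def seqCaputoDeriv (β : ℝ) (n : ℕ) (f : ℝ → ℝ) : ℝ → ℝ :=
  (caputoDeriv β)^[n] f

/-- `u : [0, ∞) → ℝ` is continuous and solves `D^{2β} u + 2 μ D^β u + γ u = 0` on `(0, ∞)` with
`u(0) = 1`, for Caputo derivatives. Only the values of `u` on `[0, ∞)` matter. -/
structure IsCaputoSolution (β μ γ : ℝ) (u : ℝ → ℝ) : Prop where
  continuousOn : ContinuousOn u (Ici 0)
  differentiable_beta : CaputoDifferentiable β u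
  differentiable_two_beta : CaputoDifferentiable (2 * β) u
  equation : ∀ t : ℝ, 0 < t →
    caputoDeriv (2 * β) u t + 2 * μ * caputoDeriv β u t + γ * u t = 0
  initial : u 0 = 1

/-- `u : [0, ∞) → ℝ` is continuous and solves `𝒟^{2β} u + 2 μ 𝒟^β u + γ u = 0` on `(0, ∞)` with
`u(0) = 1` and `𝒟^β u(0) = b`, for sequential Caputo derivatives. The initial value of `𝒟^β u` is
the limit from the right, because the Caputo derivative is defined for `t > 0` only. -/
structure IsSequentialSolution (β μ γ b : ℝ) (u : ℝ → ℝ) : Prop where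
  continuousOn : ContinuousOn u (Ici 0)
  differentiable : CaputoDifferentiable β u
  differentiable_deriv : CaputoDifferentiable β (seqCaputoDeriv β 1 u)
  equation : ∀ t : ℝ, 0 < t →
    seqCaputoDeriv β 2 u t + 2 * μ * seqCaputoDeriv β 1 u t + γ * u t = 0
  initial : u 0 = 1
  initial_deriv : Tendsto (seqCaputoDeriv β 1 u) (𝓝[>] 0) (𝓝 b)

end

/-! Existence is an eigenfunction computation. For `α < 1` the Caputo derivative is `I^{1-α}`
applied to `u'`, and termwise integration with the Beta integral gives `D^β E_β(r t^β) = r E_β(r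
t^β)` and `D^{2β} E_β(r t^β) = r² E_β(r t^β) + r t^{-β}/Γ(1-β)`. Both `r₁` and `r₂` are roots of `r²
+ 2μr + γ`, so a combination solves the sequential equation for any coefficients, and it solves the
Caputo equation once `a₁r₁ + a₂r₂ = 0` removes the singular terms. That number is also the limit of
`D^β u` at `0+`, which is why the condition `𝒟^β u(0) = 0` makes the two problems agree.

Uniqueness comes from integrating the equations: the semigroup law `fracInt_fracInt` turns the
Caputo problem into a weakly singular Volterra equation for `u`, and the sequential problem into a
system for `u` and `D^β u`. The Grönwall lemma `eq_zero_of_abs_le_integral_sub_rpow_mul` then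
annihilates the difference of two solutions.

The order is read off from the decay of `E_β` at `-∞`. Summing a geometric series under Hankel's
integral for `1/Γ` and collapsing the contour onto the negative axis gives
`mittagLeffler_neg_eq_integral`: `E_β(-x)` is `1/π` times the imaginary part of `∫ k(u)/(x + Q(u))
du` with `Re Q ≥ 0`. Dominated convergence, before and after differentiation in `x`, shows that `x
E_β(-x)` and `x² E_β'(-x)` tend to the same positive constant. Hence `t^β u → S` and `t^β · t u' →
-β S`, with `S ≠ 0` because `c₁/r₁ + c₂/r₂ = -2μ/(r₁r₂)`, and the quotient tends to `-β`. -/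

/-! ### Riemann–Liouville fractional integrals -/

/-- The Riemann–Liouville fractional integral of order `a > 0` with lower terminal `0`. -/
noncomputable def fracInt (a : ℝ) (f : ℝ → ℝ) (t : ℝ) : ℝ :=
  1 / Real.Gamma a * ∫ s in (0 : ℝ)..t, (t - s) ^ (a - 1) * f s

theorem integral_rpow_mul_sub_rpow {a b t : ℝ} (ha : 0 < a) (hb : 0 < b) (ht : 0 < t) :
    ∫ s in (0 : ℝ)..t, s ^ (a - 1) * (t - s) ^ (b - 1) =
      t ^ (a + b - 1) * (Real.Gamma a * Real.Gamma b / Real.Gamma (a + b)) := by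
  have h := Complex.betaIntegral_scaled a b ht
  rw [Complex.betaIntegral_eq_Gamma_mul_div _ _ (by simpa) (by simpa)] at h
  have h2 : ∫ x in (0 : ℝ)..t, (x : ℂ) ^ ((a : ℂ) - 1) * ((t : ℂ) - x) ^ ((b : ℂ) - 1) =
      ∫ x in (0 : ℝ)..t, ((x ^ (a - 1) * (t - x) ^ (b - 1) : ℝ) : ℂ) := by
    refine intervalIntegral.integral_congr fun x hx => ?_
    rw [uIcc_of_le ht.le] at hx
    simp only [Complex.ofReal_mul]
    rw [Complex.ofReal_cpow hx.1, Complex.ofReal_cpow (sub_nonneg.2 hx.2)]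
    push_cast
    rfl
  rw [h2, intervalIntegral.integral_ofReal, ← Complex.ofReal_add, Complex.Gamma_ofReal,
    Complex.Gamma_ofReal, Complex.Gamma_ofReal, ← Complex.ofReal_one, ← Complex.ofReal_sub,
    ← Complex.ofReal_cpow ht.le] at h
  exact_mod_cast h

theorem integral_sub_rpow_mul_sub_rpow {a b s t : ℝ} (ha : 0 < a) (hb : 0 < b) (ht : s < t) :
    ∫ x in s..t, (t - x) ^ (a - 1) * (x - s) ^ (b - 1) =
      (t - s) ^ (a + b - 1) * (Real.Gamma a * Real.Gamma b / Real.Gamma (a + b)) := by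
  have h := integral_rpow_mul_sub_rpow hb ha (sub_pos.2 ht)
  rw [show b + a = a + b from add_comm b a, mul_comm (Real.Gamma b)] at h
  rw [← h]
  have := intervalIntegral.integral_comp_sub_right (a := s) (b := t)
    (fun x => x ^ (b - 1) * (t - s - x) ^ (a - 1)) s
  rw [sub_self] at this
  rw [← this]
  refine intervalIntegral.integral_congr fun x _ => ?_
  simp only [sub_sub_sub_cancel_right]
  ring

theorem intervalIntegrable_sub_rpow_mul_sub_rpow {a b s t : ℝ} (ha : 0 < a) (hb : 0 < b)
    (ht : s < t) :
    IntervalIntegrable (fun x => (t - x) ^ (a - 1) * (x - s) ^ (b - 1)) volume s t := by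
  -- A non-integrable function has integral `0` by convention, so the positive Beta value already
  -- forces integrability.
  refine intervalIntegral.intervalIntegrable_of_integral_ne_zero ?_
  rw [integral_sub_rpow_mul_sub_rpow ha hb ht]
  have := sub_pos.2 ht
  have := Real.Gamma_pos_of_pos ha
  have := Real.Gamma_pos_of_pos hb
  have := Real.Gamma_pos_of_pos (add_pos ha hb)
  positivity

theorem intervalIntegrable_sub_rpow {a : ℝ} (ha : 0 < a) {t : ℝ} (ht : 0 < t) :
    IntervalIntegrable (fun s => (t - s) ^ (a - 1)) volume 0 t := by
  simpa using intervalIntegrable_sub_rpow_mul_sub_rpow ha one_pos ht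

theorem fracInt_one_apply (f : ℝ → ℝ) (t : ℝ) : fracInt 1 f t = ∫ s in (0 : ℝ)..t, f s := by
  simp [fracInt]

theorem fracInt_congr {a t : ℝ} {f g : ℝ → ℝ} (ht : 0 ≤ t) (h : ∀ s ∈ Ioc 0 t, f s = g s) :
    fracInt a f t = fracInt a g t := by
  rw [fracInt, fracInt, intervalIntegral.integral_of_le ht, intervalIntegral.integral_of_le ht]
  congr 1
  refine setIntegral_congr_fun measurableSet_Ioc fun s hs => ?_
  simp only [h s hs]

theorem IntervalIntegrable.congr_Ioc {t : ℝ} {f g : ℝ → ℝ} (hf : IntervalIntegrable f volume 0 t)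
    (ht : 0 ≤ t) (h : ∀ s ∈ Ioc 0 t, f s = g s) : IntervalIntegrable g volume 0 t := by
  rw [intervalIntegrable_iff_integrableOn_Ioc_of_le ht] at hf ⊢
  exact hf.congr_fun h measurableSet_Ioc

/-- The semigroup law of fractional integration, together with the integrability it rests on. -/
theorem fracInt_fracInt {a b t : ℝ} (ha : 0 < a) (hb : 0 < b) (hab : 1 ≤ a + b) (ht : 0 < t)
    {f : ℝ → ℝ} (hf : IntervalIntegrable f volume 0 t) :
    IntervalIntegrable (fun s => (t - s) ^ (a - 1) * fracInt b f s) volume 0 t ∧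
      fracInt a (fracInt b f) t = fracInt (a + b) f t := by
  set μ : Measure ℝ := volume.restrict (Ioc 0 t) with hμ
  rw [intervalIntegrable_iff_integrableOn_Ioc_of_le ht.le] at hf
  have hf' : Integrable f μ := hf
  -- The integrand is extended by zero from the triangle `s < τ` to the square, where Fubini
  -- applies; the inner integral over `τ` is a Beta integral.
  set F : ℝ → ℝ → ℝ := fun τ s =>
    {p : ℝ × ℝ | p.2 < p.1}.indicator
      (fun p => (t - p.1) ^ (a - 1) * (p.1 - p.2) ^ (b - 1) * f p.2) (τ, s) with hF
  have hGa := Real.Gamma_pos_of_pos ha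
  have hGb := Real.Gamma_pos_of_pos hb
  have hGab := Real.Gamma_pos_of_pos (add_pos ha hb)
  set B := Real.Gamma a * Real.Gamma b / Real.Gamma (a + b) with hB
  have hsec1 : ∀ τ, F τ = (Iio τ).indicator
      (fun s => (t - τ) ^ (a - 1) * (τ - s) ^ (b - 1) * f s) := by
    intro τ; ext s
    simp only [hF, indicator, mem_ofPred_eq, mem_Iio]
  have hsec2 : ∀ s, (fun τ => F τ s) = (Ioi s).indicator
      (fun τ => (t - τ) ^ (a - 1) * (τ - s) ^ (b - 1) * f s) := by
    intro s; ext τ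
    simp only [hF, indicator, mem_ofPred_eq, mem_Ioi]
  have hmeas : AEStronglyMeasurable (Function.uncurry F) (μ.prod μ) := by
    refine AEStronglyMeasurable.indicator ?_ (measurableSet_lt measurable_snd measurable_fst)
    refine AEStronglyMeasurable.mul ?_ hf'.aestronglyMeasurable.comp_snd
    refine Measurable.aestronglyMeasurable ?_
    fun_prop
  have hset : ∀ s ∈ Ioc 0 t, Ioc 0 t ∩ Ioi s = Ioc s t := by
    intro s hs; ext x; simp only [mem_inter_iff, mem_Ioc, mem_Ioi]
    constructor
    · rintro ⟨⟨h1, h2⟩, h3⟩; exact ⟨h3, h2⟩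
    · rintro ⟨h1, h2⟩; exact ⟨⟨hs.1.trans h1, h2⟩, h1⟩
  have hint2 : ∀ s ∈ Ioo 0 t, Integrable (fun τ => F τ s) μ := by
    intro s hs
    rw [hsec2, integrable_indicator_iff measurableSet_Ioi, IntegrableOn, hμ,
      Measure.restrict_restrict measurableSet_Ioi, inter_comm, hset s ⟨hs.1, hs.2.le⟩]
    have := intervalIntegrable_sub_rpow_mul_sub_rpow ha hb hs.2
    rw [intervalIntegrable_iff_integrableOn_Ioc_of_le hs.2.le] at this
    exact this.mul_const _
  have hval2 : ∀ s ∈ Ioo 0 t, ∫ τ, F τ s ∂μ = B * ((t - s) ^ (a + b - 1) * f s) := by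
    intro s hs
    rw [hsec2, integral_indicator measurableSet_Ioi, hμ,
      Measure.restrict_restrict measurableSet_Ioi, inter_comm, hset s ⟨hs.1, hs.2.le⟩,
      integral_mul_const, ← intervalIntegral.integral_of_le hs.2.le,
      integral_sub_rpow_mul_sub_rpow ha hb hs.2]
    ring
  have hnorm2 : ∀ s ∈ Ioo 0 t, ∫ τ, ‖F τ s‖ ∂μ = B * ((t - s) ^ (a + b - 1) * ‖f s‖) := by
    intro s hs
    have : (fun τ => ‖F τ s‖) = (Ioi s).indicator
      (fun τ => ‖(t - τ) ^ (a - 1) * (τ - s) ^ (b - 1) * f s‖) := by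
      ext τ
      rw [show F τ s = _ from congrFun (hsec2 s) τ, norm_indicator_eq_indicator_norm]
    rw [this, integral_indicator measurableSet_Ioi, hμ,
      Measure.restrict_restrict measurableSet_Ioi, inter_comm, hset s ⟨hs.1, hs.2.le⟩]
    have : ∫ τ in Ioc s t, ‖(t - τ) ^ (a - 1) * (τ - s) ^ (b - 1) * f s‖ =
        ∫ τ in Ioc s t, (t - τ) ^ (a - 1) * (τ - s) ^ (b - 1) * ‖f s‖ := by
      refine setIntegral_congr_fun measurableSet_Ioc fun τ hτ => ?_
      have h1 : 0 ≤ t - τ := sub_nonneg.2 hτ.2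
      have h2 : 0 ≤ τ - s := sub_nonneg.2 hτ.1.le
      rw [norm_mul, Real.norm_of_nonneg (by positivity)]
    rw [this, integral_mul_const, ← intervalIntegral.integral_of_le hs.2.le,
      integral_sub_rpow_mul_sub_rpow ha hb hs.2]
    ring
  have hae : ∀ᵐ s ∂μ, s ∈ Ioo 0 t := by
    rw [hμ, ← restrict_Ioo_eq_restrict_Ioc]
    exact ae_restrict_mem measurableSet_Ioo
  -- Here `1 ≤ a + b` is needed: the combined kernel is then bounded by `t ^ (a + b - 1)`, so
  -- integrability of `f` alone suffices.
  have hpow : Integrable (fun s => (t - s) ^ (a + b - 1) * f s) μ := by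
    refine Integrable.bdd_mul (c := t ^ (a + b - 1)) hf' ?_ ?_
    · exact Measurable.aestronglyMeasurable (by fun_prop)
    · filter_upwards [hae] with s hs
      have h1 : 0 ≤ t - s := sub_nonneg.2 hs.2.le
      rw [Real.norm_of_nonneg (by positivity)]
      exact Real.rpow_le_rpow h1 (by linarith [hs.1]) (by linarith)
  have hFint : Integrable (Function.uncurry F) (μ.prod μ) := by
    rw [integrable_prod_iff' hmeas]
    refine ⟨?_, ?_⟩
    · filter_upwards [hae] with s hs using hint2 s hs
    · refine Integrable.congr (hpow.norm.const_mul B) ?_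
      filter_upwards [hae] with s hs
      simp only [Function.uncurry]
      rw [hnorm2 s hs, norm_mul, Real.norm_of_nonneg]
      have h1 : 0 ≤ t - s := sub_nonneg.2 hs.2.le
      positivity
  have hval1 : ∀ τ ∈ Ioc 0 t,
      ∫ s, F τ s ∂μ = Real.Gamma b * ((t - τ) ^ (a - 1) * fracInt b f τ) := by
    intro τ hτ
    have hset1 : Ioc 0 t ∩ Iio τ = Ioo 0 τ := by
      ext x; simp only [mem_inter_iff, mem_Ioc, mem_Iio, mem_Ioo]
      constructor
      · rintro ⟨⟨h1, h2⟩, h3⟩; exact ⟨h1, h3⟩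
      · rintro ⟨h1, h2⟩; exact ⟨⟨h1, h2.le.trans hτ.2⟩, h2⟩
    rw [hsec1, integral_indicator measurableSet_Iio, hμ,
      Measure.restrict_restrict measurableSet_Iio, inter_comm, hset1, fracInt,
      intervalIntegral.integral_of_le hτ.1.le, restrict_Ioo_eq_restrict_Ioc]
    simp_rw [mul_assoc]
    rw [integral_const_mul]
    field_simp
  have hswap := integral_integral_swap hFint
  have hI := hFint.integral_prod_left
  have hae1 : ∀ᵐ τ ∂μ, τ ∈ Ioc 0 t := ae_restrict_mem measurableSet_Ioc
  constructor
  · rw [intervalIntegrable_iff_integrableOn_Ioc_of_le ht.le]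
    refine Integrable.congr (hI.const_mul (1 / Real.Gamma b)) ?_
    filter_upwards [hae1] with τ hτ
    simp only [Function.uncurry]
    rw [hval1 τ hτ]
    field_simp
  · have e1 : ∫ τ, ∫ s, F τ s ∂μ ∂μ =
        Real.Gamma b * ∫ τ in Ioc 0 t, (t - τ) ^ (a - 1) * fracInt b f τ := by
      rw [← integral_const_mul]
      exact setIntegral_congr_fun measurableSet_Ioc hval1
    have e2 : ∫ s, ∫ τ, F τ s ∂μ ∂μ = B * ∫ s in Ioc 0 t, (t - s) ^ (a + b - 1) * f s := by
      rw [← integral_const_mul]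
      refine integral_congr_ae ?_
      filter_upwards [hae] with s hs using hval2 s hs
    rw [e1, e2] at hswap
    rw [fracInt, fracInt, intervalIntegral.integral_of_le ht.le,
      intervalIntegral.integral_of_le ht.le]
    rw [hB] at hswap
    field_simp at hswap ⊢
    linear_combination hswap

/-- A Grönwall lemma for weakly singular Volterra inequalities. -/
theorem eq_zero_of_abs_le_integral_sub_rpow_mul {a B C T : ℝ} (ha : 0 < a) (hC : 0 ≤ C)
    {f : ℝ → ℝ} (hB : ∀ t ∈ Ioc 0 T, |f t| ≤ B)
    (h : ∀ t ∈ Ioc 0 T, |f t| ≤ C * ∫ s in (0 : ℝ)..t, (t - s) ^ (a - 1) * |f s|) :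
    ∀ t ∈ Ioc 0 T, f t = 0 := by
  -- `(1/l)^a Γ(a)` is the Laplace transform of the kernel `s^(a-1)` at `l`. With `l` large, the
  -- Volterra operator has norm at most `1/2` in the sup norm weighted by `exp (-l t)`, so each
  -- application halves a bound.
  obtain ⟨l, hl, hlC⟩ : ∃ l : ℝ, 0 < l ∧ C * ((1 / l) ^ a * Real.Gamma a) ≤ 1 / 2 := by
    have h1 : Tendsto (fun l : ℝ => C * ((1 / l) ^ a * Real.Gamma a)) atTop (𝓝 0) := by
      have h0 : Tendsto (fun l : ℝ => l ^ (-a)) atTop (𝓝 0) := tendsto_rpow_neg_atTop ha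
      have h2 := (h0.mul_const (Real.Gamma a)).const_mul C
      simp only [zero_mul, mul_zero] at h2
      refine h2.congr' ?_
      filter_upwards [eventually_gt_atTop 0] with l hl
      rw [one_div, Real.inv_rpow hl.le, Real.rpow_neg hl.le]
    obtain ⟨l, hl1, hl2⟩ := ((h1.eventually (ge_mem_nhds (by norm_num : (0 : ℝ) < 1 / 2))).and
      (eventually_gt_atTop 0)).exists
    exact ⟨l, hl2, hl1⟩
  have hstep : ∀ M : ℝ, 0 ≤ M → (∀ t ∈ Ioc 0 T, |f t| ≤ M * Real.exp (l * t)) →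
      ∀ t ∈ Ioc 0 T, |f t| ≤ M / 2 * Real.exp (l * t) := by
    intro M hM hMf t ht
    have hexp : IntegrableOn (fun s : ℝ => s ^ (a - 1) * Real.exp (-(l * s))) (Ioi 0) := by
      by_contra hcon
      have h3 := Real.integral_rpow_mul_exp_neg_mul_Ioi ha hl
      rw [integral_undef hcon] at h3
      have := Real.Gamma_pos_of_pos ha
      have : 0 < (1 / l) ^ a * Real.Gamma a := by positivity
      linarith
    have hii : IntervalIntegrable (fun s : ℝ => s ^ (a - 1) * Real.exp (-(l * s))) volume 0 t := by
      rw [intervalIntegrable_iff_integrableOn_Ioc_of_le ht.1.le]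
      exact hexp.mono_set Ioc_subset_Ioi_self
    have hii' : IntervalIntegrable
        (fun s : ℝ => (t - s) ^ (a - 1) * Real.exp (-(l * (t - s)))) volume 0 t := by
      have := (hii.comp_sub_left t).symm
      simpa using this
    have hval : ∫ s in (0 : ℝ)..t, (t - s) ^ (a - 1) * Real.exp (-(l * (t - s))) ≤
        (1 / l) ^ a * Real.Gamma a := by
      have := intervalIntegral.integral_comp_sub_left (a := 0) (b := t)
        (fun s : ℝ => s ^ (a - 1) * Real.exp (-(l * s))) t
      rw [sub_self, sub_zero] at this
      rw [this, ← Real.integral_rpow_mul_exp_neg_mul_Ioi ha hl,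
        intervalIntegral.integral_of_le ht.1.le]
      refine setIntegral_mono_set hexp ?_ (Ioc_subset_Ioi_self.eventuallyLE)
      filter_upwards [ae_restrict_mem measurableSet_Ioi] with s hs
      have : (0 : ℝ) < s := hs
      simp only [Pi.zero_apply]
      positivity
    have hle : ∫ s in (0 : ℝ)..t, (t - s) ^ (a - 1) * |f s| ≤
        ∫ s in (0 : ℝ)..t, M * Real.exp (l * t) *
          ((t - s) ^ (a - 1) * Real.exp (-(l * (t - s)))) := by
      rw [intervalIntegral.integral_of_le ht.1.le, intervalIntegral.integral_of_le ht.1.le]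
      refine integral_mono_of_nonneg ?_ ?_ ?_
      · filter_upwards [ae_restrict_mem measurableSet_Ioc] with s hs
        have : 0 ≤ t - s := sub_nonneg.2 hs.2
        simp only [Pi.zero_apply]
        positivity
      · have := hii'.const_mul (M * Real.exp (l * t))
        rwa [intervalIntegrable_iff_integrableOn_Ioc_of_le ht.1.le] at this
      · filter_upwards [ae_restrict_mem measurableSet_Ioc] with s hs
        have h0 : 0 ≤ t - s := sub_nonneg.2 hs.2
        have h1 := hMf s ⟨hs.1, hs.2.trans ht.2⟩
        have h2 : M * Real.exp (l * t) * ((t - s) ^ (a - 1) * Real.exp (-(l * (t - s)))) =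
            (t - s) ^ (a - 1) * (M * Real.exp (l * s)) := by
          have : Real.exp (l * s) = Real.exp (l * t) * Real.exp (-(l * (t - s))) := by
            rw [← Real.exp_add]; ring_nf
          rw [this]; ring
        rw [h2]
        gcongr
    calc |f t| ≤ C * ∫ s in (0 : ℝ)..t, (t - s) ^ (a - 1) * |f s| := h t ht
      _ ≤ C * (M * Real.exp (l * t) * ((1 / l) ^ a * Real.Gamma a)) := by
          rw [intervalIntegral.integral_const_mul] at hle
          gcongr
          exact hle.trans (by gcongr)
      _ = M * Real.exp (l * t) * (C * ((1 / l) ^ a * Real.Gamma a)) := by ring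
      _ ≤ M * Real.exp (l * t) * (1 / 2) := by gcongr
      _ = M / 2 * Real.exp (l * t) := by ring
  intro t ht
  have hB0 : 0 ≤ B := (abs_nonneg _).trans (hB t ht)
  have hn : ∀ n : ℕ, ∀ t ∈ Ioc 0 T, |f t| ≤ B / 2 ^ n * Real.exp (l * t) := by
    intro n
    induction n with
    | zero =>
      intro t ht
      have h1 : 1 ≤ Real.exp (l * t) := Real.one_le_exp (by have := ht.1; positivity)
      have h2 := hB t ht
      simp only [pow_zero, div_one]
      nlinarith
    | succ n ih =>
      have := hstep _ (by positivity) ih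
      intro t ht
      rw [pow_succ, ← div_div]
      exact this t ht
  have hlim : Tendsto (fun n : ℕ => B / 2 ^ n * Real.exp (l * t)) atTop (𝓝 0) := by
    have := (tendsto_pow_atTop_nhds_zero_of_lt_one (by norm_num : (0 : ℝ) ≤ 1 / 2)
      (by norm_num)).const_mul (B * Real.exp (l * t))
    rw [mul_zero] at this
    refine this.congr fun n => ?_
    rw [one_div, inv_pow]
    ring
  have := ge_of_tendsto' hlim fun n => hn n t ht
  exact abs_eq_zero.1 (le_antisymm this (abs_nonneg _))

/-! ### The two-parameter Mittag-Leffler function -/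

/-- The two-parameter Mittag-Leffler function `E_{a,b}(z) = ∑ z ^ k / Γ(k a + b)`. -/
noncomputable def mittagLefflerTwo (a b z : ℝ) : ℝ :=
  ∑' k : ℕ, z ^ k / Real.Gamma (k * a + b)

theorem mittagLefflerTwo_one (a z : ℝ) : mittagLefflerTwo a 1 z = mittagLeffler a z := rfl

/-- Only the part `s > R` of Euler's integral is kept, where `s^(x-1) ≥ R^(x-1)`. Since `R` is free,
`Γ` outgrows every exponential, which is all that convergence of the Mittag-Leffler series needs. -/
theorem rpow_mul_exp_neg_le_Gamma {x R : ℝ} (hx : 1 ≤ x) (hR : 0 < R) :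
    R ^ (x - 1) * Real.exp (-R) ≤ Real.Gamma x := by
  have hconv := Real.GammaIntegral_convergent (zero_lt_one.trans_le hx)
  rw [Real.Gamma_eq_integral (zero_lt_one.trans_le hx), ← integral_exp_neg_Ioi,
    ← integral_const_mul]
  have h1 : ∫ s in Ioi R, R ^ (x - 1) * Real.exp (-s) ≤
      ∫ s in Ioi R, Real.exp (-s) * s ^ (x - 1) := by
    refine setIntegral_mono_on ((integrableOn_exp_neg_Ioi R).const_mul _)
      (hconv.mono_set (Ioi_subset_Ioi hR.le)) measurableSet_Ioi fun s hs => ?_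
    rw [mul_comm]
    have : R ≤ s := le_of_lt hs
    gcongr
  refine h1.trans (setIntegral_mono_set hconv ?_ (Ioi_subset_Ioi hR.le).eventuallyLE)
  filter_upwards [ae_restrict_mem measurableSet_Ioi] with s hs
  have : (0 : ℝ) < s := hs
  simp only [Pi.zero_apply]
  positivity

theorem summable_abs_pow_div_Gamma {a b : ℝ} (ha : 0 < a) (hb : 0 < b) (z : ℝ) :
    Summable fun k : ℕ => |z| ^ k / Real.Gamma (k * a + b) := by
  -- With `R ^ a = q > 2|z|`, the lower bound on `Γ(ka + b)` leaves a geometric series of ratio at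
  -- most `1/2`.
  set q : ℝ := 2 * (|z| + 1) with hq
  have hq0 : 0 < q := by positivity
  set R : ℝ := q ^ (1 / a) with hR
  have hR0 : 0 < R := by positivity
  have hRa : R ^ a = q := by
    rw [hR, ← Real.rpow_mul hq0.le, one_div_mul_cancel ha.ne', Real.rpow_one]
  have hs : Summable fun k : ℕ => Real.exp R * R ^ (1 - b) * (1 / 2) ^ k :=
    summable_geometric_two.mul_left _
  refine Summable.of_norm_bounded_eventually_nat hs ?_
  have hev : ∀ᶠ k : ℕ in atTop, 1 ≤ (k : ℝ) * a + b := by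
    have := (tendsto_natCast_atTop_atTop (R := ℝ)).atTop_mul_const ha
    filter_upwards [this.eventually_ge_atTop 1] with k hk
    linarith
  filter_upwards [hev] with k hk
  have hG := rpow_mul_exp_neg_le_Gamma hk hR0
  have hpos : 0 < R ^ ((k : ℝ) * a + b - 1) * Real.exp (-R) := by positivity
  have hG0 := hpos.trans_le hG
  rw [Real.norm_of_nonneg (by positivity)]
  calc |z| ^ k / Real.Gamma (k * a + b)
      ≤ |z| ^ k / (R ^ ((k : ℝ) * a + b - 1) * Real.exp (-R)) := by gcongr
    _ = Real.exp R * R ^ (1 - b) * (|z| / q) ^ k := by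
        have : R ^ ((k : ℝ) * a + b - 1) = q ^ k / R ^ (1 - b) := by
          rw [← hRa, ← Real.rpow_natCast, ← Real.rpow_mul hR0.le, ← Real.rpow_sub hR0]
          ring_nf
        rw [this, Real.exp_neg, div_pow]
        have : R ^ (1 - b) ≠ 0 := by positivity
        field_simp
    _ ≤ Real.exp R * R ^ (1 - b) * (1 / 2) ^ k := by
        refine mul_le_mul_of_nonneg_left (pow_le_pow_left₀ (by positivity) ?_ k) (by positivity)
        rw [div_le_div_iff₀ hq0 two_pos]
        linarith

theorem Gamma_mul_add_pos {a b : ℝ} (ha : 0 < a) (hb : 0 < b) (k : ℕ) :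
    0 < Real.Gamma (k * a + b) :=
  Real.Gamma_pos_of_pos (by positivity)

theorem hasSum_mittagLefflerTwo {a b : ℝ} (ha : 0 < a) (hb : 0 < b) (z : ℝ) :
    HasSum (fun k : ℕ => z ^ k / Real.Gamma (k * a + b)) (mittagLefflerTwo a b z) := by
  refine Summable.hasSum (Summable.of_norm ?_)
  refine (summable_abs_pow_div_Gamma ha hb z).congr fun k => ?_
  rw [norm_div, norm_pow, Real.norm_eq_abs, Real.norm_of_nonneg (Gamma_mul_add_pos ha hb k).le]

/-- For `b = 1 - β` the constant term split off here becomes the singular part of `D^{2β} E_β(r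
t^β)`. -/
theorem mittagLefflerTwo_eq_add {a b : ℝ} (ha : 0 < a) (hb : 0 < b) (z : ℝ) :
    mittagLefflerTwo a b z = 1 / Real.Gamma b + z * mittagLefflerTwo a (a + b) z := by
  have h := (hasSum_mittagLefflerTwo ha hb z).summable
  rw [mittagLefflerTwo, h.tsum_eq_zero_add, mittagLefflerTwo, ← tsum_mul_left]
  congr 1
  · simp
  · refine tsum_congr fun k => ?_
    push_cast
    rw [show ((k : ℝ) + 1) * a + b = k * a + (a + b) by ring]
    ring

theorem continuous_mittagLefflerTwo {a b : ℝ} (ha : 0 < a) (hb : 0 < b) :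
    Continuous (mittagLefflerTwo a b) := by
  have key : ∀ R : ℝ, 0 ≤ R → ContinuousOn (mittagLefflerTwo a b) (Icc (-R) R) := by
    intro R hR
    refine continuousOn_tsum (fun k => by fun_prop) (summable_abs_pow_div_Gamma ha hb R) ?_
    intro k z hz
    rw [norm_div, norm_pow, Real.norm_eq_abs, Real.norm_of_nonneg (Gamma_mul_add_pos ha hb k).le]
    have := Gamma_mul_add_pos ha hb k
    have hzR : |z| ≤ |R| := (abs_le.2 hz).trans (le_abs_self R)
    gcongr
  refine continuous_iff_continuousAt.2 fun z => (key (|z| + 1) (by positivity)).continuousAt ?_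
  refine Icc_mem_nhds ?_ ?_
  · linarith [neg_abs_le z]
  · linarith [le_abs_self z]

theorem mittagLeffler_zero (a : ℝ) : mittagLeffler a 0 = 1 := by
  rw [mittagLeffler, tsum_eq_single 0]
  · simp
  · intro k hk
    simp [hk]

theorem hasDerivAt_mittagLeffler {a : ℝ} (ha : 0 < a) (z : ℝ) :
    HasDerivAt (mittagLeffler a) (1 / a * mittagLefflerTwo a a z) z := by
  set R : ℝ := |z| + 1
  have hR : 0 ≤ R := by positivity
  -- At `k = 0` the truncated exponent `k - 1` is harmless because of the factor `k`. After a shift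
  -- by one, `Γ(z + 1) = z Γ(z)` with `z = (k + 1) a` turns these terms into those of `E_{a,a}`.
  set g' : ℕ → ℝ → ℝ := fun k y => k * y ^ (k - 1) / Real.Gamma (k * a + 1)
  have hterm : ∀ (k : ℕ) (y : ℝ),
      g' (k + 1) y = 1 / a * (y ^ k / Real.Gamma (k * a + a)) := by
    intro k y
    have hk : ((k : ℝ) + 1) * a ≠ 0 := by positivity
    simp only [g']
    push_cast
    rw [Real.Gamma_add_one hk]
    have := Gamma_mul_add_pos ha ha k
    have h0 : (k : ℝ) + 1 ≠ 0 := by positivity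
    rw [show (k : ℝ) * a + a = (k + 1) * a by ring] at *
    field_simp
  have hsum : Summable fun k : ℕ => |g' k R| := by
    rw [← summable_nat_add_iff 1]
    refine ((summable_abs_pow_div_Gamma ha ha R).mul_left (1 / a)).congr fun k => ?_
    have := Gamma_mul_add_pos ha ha k
    rw [hterm, abs_of_nonneg hR, abs_of_nonneg (by positivity)]
  have hder := hasDerivAt_tsum_of_isPreconnected
    (g := fun (k : ℕ) (y : ℝ) => y ^ k / Real.Gamma (k * a + 1)) (g' := g') hsum
    (isOpen_Ioo (a := -R) (b := R)) isPreconnected_Ioo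
    (fun k y _ => (hasDerivAt_pow k y).div_const _)
    (fun k y hy => by
      have h1 : |y| ≤ R := abs_le.2 ⟨hy.1.le, hy.2.le⟩
      have := Gamma_mul_add_pos ha one_pos k
      simp only [g']
      rw [Real.norm_eq_abs, abs_div, abs_div, abs_mul, abs_mul, abs_pow, abs_pow,
        abs_of_nonneg hR]
      gcongr)
    (y₀ := 0) ⟨by linarith [abs_nonneg z], by positivity⟩
    (by
      have := hasSum_mittagLefflerTwo ha one_pos 0
      exact this.summable)
    (y := z) (by
      constructor
      · linarith [neg_abs_le z]
      · linarith [le_abs_self z])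
  have hval : ∑' k, g' k z = 1 / a * mittagLefflerTwo a a z := by
    have hs : Summable fun k => g' k z := by
      rw [← summable_nat_add_iff 1]
      refine ((hasSum_mittagLefflerTwo ha ha z).summable.mul_left (1 / a)).congr fun k => ?_
      rw [hterm]
    rw [hs.tsum_eq_zero_add, mittagLefflerTwo, ← tsum_mul_left]
    simp only [hterm]
    simp [g']
  rw [hval] at hder
  exact hder

/-! ### Caputo derivatives of order less than one -/

theorem caputoDeriv_eq_fracInt {α : ℝ} (h0 : 0 < α) (h1 : α < 1) (f : ℝ → ℝ) (t : ℝ) :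
    caputoDeriv α f t = fracInt (1 - α) (deriv f) t := by
  have hc : ⌈α⌉₊ = 1 := by
    rw [Nat.ceil_eq_iff one_ne_zero]; simp [h0, h1.le]
  rw [caputoDeriv, hc, iteratedDeriv_one, fracInt, Nat.cast_one]

theorem caputoDifferentiable_iff {α : ℝ} (h0 : 0 < α) (h1 : α < 1) {f : ℝ → ℝ} :
    CaputoDifferentiable α f ↔ (∀ t, 0 < t → DifferentiableAt ℝ f t) ∧
      ContinuousOn (deriv f) (Ioi 0) ∧ ∀ t, 0 < t →
        IntervalIntegrable (fun s => (t - s) ^ (1 - α - 1) * deriv f s) volume 0 t := by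
  have hc : ⌈α⌉₊ = 1 := by
    rw [Nat.ceil_eq_iff one_ne_zero]; simp [h0, h1.le]
  have hcd : ContDiffOn ℝ (⌈α⌉₊ : ℕ) f (Ioi 0) ↔
      (∀ t, 0 < t → DifferentiableAt ℝ f t) ∧ ContinuousOn (deriv f) (Ioi 0) := by
    rw [hc, show ((1 : ℕ) : WithTop ℕ∞) = 0 + 1 by simp,
      contDiffOn_succ_iff_deriv_of_isOpen isOpen_Ioi]
    simp only [contDiffOn_zero, WithTop.zero_ne_top, false_imp_iff, true_and]
    refine and_congr_left fun _ => ⟨fun h t ht => ?_, fun h t ht => ?_⟩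
    · exact (h t ht).differentiableAt (Ioi_mem_nhds ht)
    · exact (h t ht).differentiableWithinAt
  constructor
  · rintro ⟨h2, h3⟩
    rw [hcd] at h2
    refine ⟨h2.1, h2.2, fun t ht => ?_⟩
    have := h3 t ht
    rwa [hc, iteratedDeriv_one, Nat.cast_one] at this
  · rintro ⟨h2, h3, h4⟩
    refine ⟨hcd.2 ⟨h2, h3⟩, fun t ht => ?_⟩
    have := h4 t ht
    rwa [hc, iteratedDeriv_one, Nat.cast_one]

/-- The kernel of a Caputo derivative is bounded below, so the derivative itself is integrable. -/
theorem CaputoDifferentiable.intervalIntegrable_deriv {α : ℝ} (h0 : 0 < α) (h1 : α < 1)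
    {f : ℝ → ℝ} (hf : CaputoDifferentiable α f) {t : ℝ} (ht : 0 < t) :
    IntervalIntegrable (deriv f) volume 0 t := by
  obtain ⟨-, -, h⟩ := (caputoDifferentiable_iff h0 h1).1 hf
  -- The bounded factor `(t - s)^α` cancels the kernel `(t - s)^(-α)` on the open interval; at `s =
  -- t` the cancellation fails, hence the passage to `Ioo` below.
  have h2 : IntervalIntegrable (fun s => (t - s) ^ α * ((t - s) ^ (1 - α - 1) * deriv f s))
      volume 0 t := by
    refine (h t ht).continuousOn_mul ?_
    refine ContinuousOn.rpow_const (by fun_prop) fun s _ => Or.inr h0.le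
  have h3 : IntervalIntegrable (deriv f) volume 0 t := by
    rw [intervalIntegrable_iff_integrableOn_Ioo_of_le ht.le] at h2 ⊢
    refine h2.congr_fun (fun s hs => ?_) measurableSet_Ioo
    have : 0 < t - s := sub_pos.2 hs.2
    simp only
    rw [← mul_assoc, ← Real.rpow_add this]
    simp
  exact h3

/-- The fundamental theorem of calculus for a function with a Caputo derivative. -/
theorem CaputoDifferentiable.eq_add_fracInt_one {α : ℝ} (h0 : 0 < α) (h1 : α < 1)
    {f : ℝ → ℝ} {c : ℝ} (hf : CaputoDifferentiable α f) (hc : Tendsto f (𝓝[>] 0) (𝓝 c))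
    {t : ℝ} (ht : 0 < t) : f t = c + fracInt 1 (deriv f) t := by
  have hi := hf.intervalIntegrable_deriv h0 h1 ht
  obtain ⟨hd, -, -⟩ := (caputoDifferentiable_iff h0 h1).1 hf
  -- Only the limit at `0+` enters, not the value at `0`; this lets the same statement serve `D^β
  -- u`, which is meaningful for `t > 0` only.
  rw [fracInt_one_apply, intervalIntegral.integral_eq_sub_of_hasDerivAt_of_tendsto ht
    (fun x hx => (hd x hx.1).hasDerivAt) hi hc
    ((hd t ht).continuousAt.tendsto.mono_left nhdsWithin_le_nhds)]
  ring

/-! ### The functions `t ↦ E_β(r t ^ β)` -/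

section MittagLefflerRpow

variable {β : ℝ}

theorem hasDerivAt_mittagLeffler_rpow (hβ : 0 < β) (r : ℝ) {t : ℝ} (ht : 0 < t) :
    HasDerivAt (fun t : ℝ => mittagLeffler β (r * t ^ β))
      (t ^ (β - 1) * (r * mittagLefflerTwo β β (r * t ^ β))) t := by
  have h1 : HasDerivAt (fun t : ℝ => r * t ^ β) (r * (β * t ^ (β - 1))) t :=
    (Real.hasDerivAt_rpow_const (Or.inl ht.ne')).const_mul r
  refine ((hasDerivAt_mittagLeffler hβ (r * t ^ β)).comp t h1).congr_deriv ?_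
  field_simp

theorem continuous_mittagLeffler (hβ : 0 < β) : Continuous (mittagLeffler β) :=
  continuous_mittagLefflerTwo hβ one_pos

theorem continuous_mittagLeffler_rpow (hβ : 0 < β) (r : ℝ) :
    Continuous fun t : ℝ => mittagLeffler β (r * t ^ β) :=
  (continuous_mittagLeffler hβ).comp (continuous_const.mul (Real.continuous_rpow_const hβ.le))

theorem deriv_mittagLeffler_rpow (hβ : 0 < β) (r : ℝ) {t : ℝ} (ht : 0 < t) :
    deriv (fun t : ℝ => mittagLeffler β (r * t ^ β)) t =
      t ^ (β - 1) * (r * mittagLefflerTwo β β (r * t ^ β)) :=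
  (hasDerivAt_mittagLeffler_rpow hβ r ht).deriv

theorem caputoDifferentiable_mittagLeffler_rpow (hβ : 0 < β) (r : ℝ) {α : ℝ} (h0 : 0 < α)
    (h1 : α < 1) : CaputoDifferentiable α fun t : ℝ => mittagLeffler β (r * t ^ β) := by
  have hc : Continuous fun t : ℝ => r * mittagLefflerTwo β β (r * t ^ β) :=
    continuous_const.mul ((continuous_mittagLefflerTwo hβ hβ).comp
      (continuous_const.mul (Real.continuous_rpow_const hβ.le)))
  rw [caputoDifferentiable_iff h0 h1]
  refine ⟨fun t ht => (hasDerivAt_mittagLeffler_rpow hβ r ht).differentiableAt, ?_, ?_⟩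
  · refine ContinuousOn.congr ?_ fun t ht => deriv_mittagLeffler_rpow hβ r ht
    refine ContinuousOn.mul ?_ hc.continuousOn
    exact continuousOn_id.rpow_const fun t ht => Or.inl (ne_of_gt ht)
  · intro t ht
    have h2 := intervalIntegrable_sub_rpow_mul_sub_rpow (sub_pos.2 h1) hβ ht
    refine (h2.mul_continuousOn hc.continuousOn).congr_Ioc ht.le fun s hs => ?_
    rw [deriv_mittagLeffler_rpow hβ r hs.1, sub_zero]
    ring

/-- Caputo derivatives of `E_β(r t ^ β)`, by termwise integration. -/
theorem caputoDeriv_mittagLeffler_rpow (hβ : 0 < β) (r : ℝ) {α : ℝ} (h0 : 0 < α)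
    (h1 : α < 1) {t : ℝ} (ht : 0 < t) :
    caputoDeriv α (fun t : ℝ => mittagLeffler β (r * t ^ β)) t =
      r * t ^ (β - α) * mittagLefflerTwo β (β + 1 - α) (r * t ^ β) := by
  have hα1 : 0 < 1 - α := sub_pos.2 h1
  have hb : 0 < β + 1 - α := by linarith
  have hG := Real.Gamma_pos_of_pos hα1
  set g : ℝ → ℕ → ℝ → ℝ := fun c k s =>
    (t - s) ^ (1 - α - 1) * (c * (r ^ k / Real.Gamma (k * β + β) * s ^ (k * β + β - 1))) with hg
  have hkβ : ∀ k : ℕ, 0 < (k : ℝ) * β + β := fun k => by positivity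
  have hint : ∀ k, IntegrableOn (g r k) (Ioc 0 t) := by
    intro k
    have h2 := intervalIntegrable_sub_rpow_mul_sub_rpow hα1 (hkβ k) ht
    rw [intervalIntegrable_iff_integrableOn_Ioc_of_le ht.le] at h2
    refine (h2.const_mul (r * (r ^ k / Real.Gamma (k * β + β)))).congr ?_
    refine Eventually.of_forall fun s => ?_
    simp only [hg, sub_zero]
    ring
  -- The numerator `c` is left free because the formula is used twice: with `|r| * |r|^k` for
  -- summability of the norms and with `r * r^k` for the sum itself.
  have hval : ∀ (c : ℝ) (k : ℕ), ∫ s in Ioc 0 t, (t - s) ^ (1 - α - 1) *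
      (c / Real.Gamma (k * β + β) * s ^ (k * β + β - 1)) =
      Real.Gamma (1 - α) * (t ^ (β - α) * (c * (t ^ β) ^ k /
        Real.Gamma (k * β + (β + 1 - α)))) := by
    intro c k
    have h2 := integral_sub_rpow_mul_sub_rpow hα1 (hkβ k) ht
    rw [intervalIntegral.integral_of_le ht.le] at h2
    simp only [sub_zero] at h2
    have h3 : t ^ (1 - α + (k * β + β) - 1) = t ^ (β - α) * (t ^ β) ^ k := by
      rw [← Real.rpow_natCast, ← Real.rpow_mul ht.le, ← Real.rpow_add ht]
      ring_nf
    have h4 := Gamma_mul_add_pos hβ hβ k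
    have h5 := Gamma_mul_add_pos hβ hb k
    rw [show (1 - α + (k * β + β) : ℝ) = k * β + (β + 1 - α) by ring] at h2
    rw [show (1 - α + (k * β + β) - 1 : ℝ) = k * β + (β + 1 - α) - 1 by ring] at h3
    calc _ = ∫ s in Ioc 0 t, c / Real.Gamma (k * β + β) *
          ((t - s) ^ (1 - α - 1) * s ^ (k * β + β - 1)) := by
          congr 1; ext s; ring
      _ = _ := by
          rw [integral_const_mul, h2, h3]
          field_simp
  have hnorm : ∀ k, ∫ s in Ioc 0 t, ‖g r k s‖ = |r| * (Real.Gamma (1 - α) * t ^ (β - α)) *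
      (|r * t ^ β| ^ k / Real.Gamma (k * β + (β + 1 - α))) := by
    intro k
    have : ∫ s in Ioc 0 t, ‖g r k s‖ = ∫ s in Ioc 0 t, (t - s) ^ (1 - α - 1) *
        ((|r| * |r| ^ k) / Real.Gamma (k * β + β) * s ^ (k * β + β - 1)) := by
      refine setIntegral_congr_fun measurableSet_Ioc fun s hs => ?_
      have h2 : 0 ≤ t - s := sub_nonneg.2 hs.2
      have h3 : 0 < s := hs.1
      have h4 := Gamma_mul_add_pos hβ hβ k
      simp only [hg]
      rw [norm_mul, norm_mul, norm_mul, norm_div, norm_pow, Real.norm_of_nonneg h4.le,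
        Real.norm_of_nonneg (by positivity : 0 ≤ (t - s) ^ (1 - α - 1)),
        Real.norm_of_nonneg (by positivity : 0 ≤ s ^ (k * β + β - 1)), Real.norm_eq_abs]
      ring
    rw [this, hval, abs_mul, mul_pow, abs_of_pos (by positivity : 0 < t ^ β)]
    ring
  have hsum : Summable fun k => ∫ s in Ioc 0 t, ‖g r k s‖ := by
    simp only [hnorm]
    exact (summable_abs_pow_div_Gamma hβ hb (r * t ^ β)).mul_left _
  have key := hasSum_integral_of_summable_integral_norm hint hsum
  have hpt : ∀ s ∈ Ioc 0 t, ∑' k, g r k s =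
      (t - s) ^ (1 - α - 1) * deriv (fun t : ℝ => mittagLeffler β (r * t ^ β)) s := by
    intro s hs
    rw [deriv_mittagLeffler_rpow hβ r hs.1]
    have h2 := (hasSum_mittagLefflerTwo hβ hβ (r * s ^ β)).mul_left
      ((t - s) ^ (1 - α - 1) * (s ^ (β - 1) * r))
    rw [mul_assoc, mul_assoc] at h2
    rw [← h2.tsum_eq]
    refine tsum_congr fun k => ?_
    have h3 : s ^ (k * β + β - 1) = s ^ (β - 1) * (s ^ β) ^ k := by
      rw [← Real.rpow_natCast, ← Real.rpow_mul hs.1.le, ← Real.rpow_add hs.1]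
      ring_nf
    simp only [hg, h3]
    ring
  rw [caputoDeriv_eq_fracInt h0 h1, fracInt, intervalIntegral.integral_of_le ht.le,
    ← setIntegral_congr_fun measurableSet_Ioc hpt, ← key.tsum_eq]
  have h2 : ∀ k, ∫ s in Ioc 0 t, g r k s = Real.Gamma (1 - α) * (r * t ^ (β - α) *
      ((r * t ^ β) ^ k / Real.Gamma (k * β + (β + 1 - α)))) := by
    intro k
    have h3 := hval (r * r ^ k) k
    simp only [hg, ← mul_assoc, ← mul_div_assoc] at h3 ⊢
    rw [h3, mul_pow]
    ring
  simp only [h2]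
  rw [tsum_mul_left, tsum_mul_left, mittagLefflerTwo]
  field_simp

theorem caputoDeriv_self_mittagLeffler_rpow (hβ : 0 < β) (hβ1 : β < 1) (r : ℝ) {t : ℝ}
    (ht : 0 < t) : caputoDeriv β (fun t : ℝ => mittagLeffler β (r * t ^ β)) t =
      r * mittagLeffler β (r * t ^ β) := by
  rw [caputoDeriv_mittagLeffler_rpow hβ r hβ hβ1 ht, sub_self, Real.rpow_zero,
    mul_one, add_sub_cancel_left, mittagLefflerTwo_one]

/-- The term in `t^(-β)` is exactly what separates `D^{2β}` from `D^β D^β` on these functions. It is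
linear in `r`, so it cancels in combinations with `a₁r₁ + a₂r₂ = 0`. -/
theorem caputoDeriv_two_mul_mittagLeffler_rpow (hβ : 0 < β) (hβ1 : β < 1 / 2) (r : ℝ) {t : ℝ}
    (ht : 0 < t) : caputoDeriv (2 * β) (fun t : ℝ => mittagLeffler β (r * t ^ β)) t =
      r * (t ^ (-β) / Real.Gamma (1 - β)) + r ^ 2 * mittagLeffler β (r * t ^ β) := by
  rw [caputoDeriv_mittagLeffler_rpow hβ r (by linarith) (by linarith) ht,
    show β + 1 - 2 * β = 1 - β by ring, show β - 2 * β = -β by ring,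
    mittagLefflerTwo_eq_add hβ (by linarith), show β + (1 - β) = 1 by ring,
    mittagLefflerTwo_one, Real.rpow_neg ht.le]
  field_simp

end MittagLefflerRpow

/-! ### Linearity and locality of the Caputo derivative -/

theorem CaputoDifferentiable.linearCombination {α : ℝ} (h0 : 0 < α) (h1 : α < 1) {f g : ℝ → ℝ}
    (hf : CaputoDifferentiable α f) (hg : CaputoDifferentiable α g) (a b : ℝ) :
    CaputoDifferentiable α (fun t => a * f t + b * g t) ∧
      ∀ t, 0 < t → caputoDeriv α (fun t => a * f t + b * g t) t =
        a * caputoDeriv α f t + b * caputoDeriv α g t := by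
  obtain ⟨f1, f2, f3⟩ := (caputoDifferentiable_iff h0 h1).1 hf
  obtain ⟨g1, g2, g3⟩ := (caputoDifferentiable_iff h0 h1).1 hg
  have hd : ∀ t, 0 < t → HasDerivAt (fun t => a * f t + b * g t)
      (a * deriv f t + b * deriv g t) t := fun t ht =>
    ((f1 t ht).hasDerivAt.const_mul a).add ((g1 t ht).hasDerivAt.const_mul b)
  constructor
  · rw [caputoDifferentiable_iff h0 h1]
    refine ⟨fun t ht => (hd t ht).differentiableAt, ?_, fun t ht => ?_⟩
    · exact ((f2.const_mul a).add (g2.const_mul b)).congr fun t ht => (hd t ht).deriv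
    · refine (((f3 t ht).const_mul a).add ((g3 t ht).const_mul b)).congr_Ioc ht.le fun s hs => ?_
      rw [(hd s hs.1).deriv]
      ring
  · intro t ht
    simp only [caputoDeriv_eq_fracInt h0 h1]
    rw [fracInt_congr ht.le fun s hs => (hd s hs.1).deriv]
    simp only [fracInt]
    have : ∀ s, (t - s) ^ (1 - α - 1) * (a * deriv f s + b * deriv g s) =
        a * ((t - s) ^ (1 - α - 1) * deriv f s) + b * ((t - s) ^ (1 - α - 1) * deriv g s) :=
      fun s => by ring
    simp only [this]
    rw [intervalIntegral.integral_add ((f3 t ht).const_mul a) ((g3 t ht).const_mul b),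
      intervalIntegral.integral_const_mul, intervalIntegral.integral_const_mul]
    ring

theorem deriv_eqOn_Ioi {f g : ℝ → ℝ} (h : ∀ t, 0 < t → f t = g t) :
    ∀ t, 0 < t → deriv f t = deriv g t := fun t ht => by
  refine Filter.EventuallyEq.deriv_eq ?_
  filter_upwards [Ioi_mem_nhds ht] with s hs using h s hs

theorem CaputoDifferentiable.congr_Ioi {α : ℝ} (h0 : 0 < α) (h1 : α < 1) {f g : ℝ → ℝ}
    (hf : CaputoDifferentiable α f) (h : ∀ t, 0 < t → f t = g t) : CaputoDifferentiable α g := by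
  have hd := deriv_eqOn_Ioi h
  obtain ⟨f1, f2, f3⟩ := (caputoDifferentiable_iff h0 h1).1 hf
  rw [caputoDifferentiable_iff h0 h1]
  refine ⟨fun t ht => (f1 t ht).congr_of_eventuallyEq ?_, f2.congr fun t ht => (hd t ht).symm,
    fun t ht => (f3 t ht).congr_Ioc ht.le fun s hs => by rw [hd s hs.1]⟩
  filter_upwards [Ioi_mem_nhds ht] with s hs using (h s hs).symm

/-- Closed forms of `D^β u` hold for `t > 0` only, and applying `D^β` again has to rest on agreement
there alone. -/
theorem caputoDeriv_congr_Ioi {α : ℝ} (h0 : 0 < α) (h1 : α < 1) {f g : ℝ → ℝ}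
    (h : ∀ t, 0 < t → f t = g t) : ∀ t, 0 < t → caputoDeriv α f t = caputoDeriv α g t := by
  intro t ht
  rw [caputoDeriv_eq_fracInt h0 h1, caputoDeriv_eq_fracInt h0 h1]
  exact fracInt_congr ht.le fun s hs => deriv_eqOn_Ioi h s hs.1

theorem seqCaputoDeriv_one (β : ℝ) (f : ℝ → ℝ) : seqCaputoDeriv β 1 f = caputoDeriv β f := rfl

theorem seqCaputoDeriv_two (β : ℝ) (f : ℝ → ℝ) :
    seqCaputoDeriv β 2 f = caputoDeriv β (caputoDeriv β f) := rfl

theorem IsCaputoSolution.congr {β μ γ : ℝ} (hβ : 0 < β) (hβ1 : β < 1 / 2) {u v : ℝ → ℝ}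
    (hu : IsCaputoSolution β μ γ u) (h : ∀ t, 0 ≤ t → u t = v t) : IsCaputoSolution β μ γ v := by
  have h' : ∀ t, 0 < t → u t = v t := fun t ht => h t ht.le
  refine ⟨hu.continuousOn.congr fun t ht => (h t ht).symm,
    hu.differentiable_beta.congr_Ioi hβ (by linarith) h',
    hu.differentiable_two_beta.congr_Ioi (by linarith) (by linarith) h', fun t ht => ?_,
    (h 0 le_rfl) ▸ hu.initial⟩
  rw [← hu.equation t ht, caputoDeriv_congr_Ioi (by linarith) (by linarith) h' t ht,
    caputoDeriv_congr_Ioi hβ (by linarith) h' t ht, h' t ht]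

theorem IsSequentialSolution.congr {β μ γ b : ℝ} (hβ : 0 < β) (hβ1 : β < 1 / 2) {u v : ℝ → ℝ}
    (hu : IsSequentialSolution β μ γ b u) (h : ∀ t, 0 ≤ t → u t = v t) :
    IsSequentialSolution β μ γ b v := by
  have h' : ∀ t, 0 < t → u t = v t := fun t ht => h t ht.le
  have hβ2 : β < 1 := by linarith
  have h'' : ∀ t, 0 < t → seqCaputoDeriv β 1 u t = seqCaputoDeriv β 1 v t :=
    caputoDeriv_congr_Ioi hβ hβ2 h'
  refine ⟨hu.continuousOn.congr fun t ht => (h t ht).symm,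
    hu.differentiable.congr_Ioi hβ hβ2 h',
    hu.differentiable_deriv.congr_Ioi hβ hβ2 h'', fun t ht => ?_,
    (h 0 le_rfl) ▸ hu.initial, hu.initial_deriv.congr' ?_⟩
  · simp only [seqCaputoDeriv_one] at h''
    rw [← hu.equation t ht, seqCaputoDeriv_two, seqCaputoDeriv_two, seqCaputoDeriv_one,
      seqCaputoDeriv_one, caputoDeriv_congr_Ioi hβ hβ2 h'' t ht, h'' t ht, h' t ht]
  · filter_upwards [self_mem_nhdsWithin] with t ht using h'' t ht

/-! ### Combinations of Mittag-Leffler functions -/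

section Combination

variable {β : ℝ}

theorem caputoDeriv_mittagLeffler_combination (hβ : 0 < β) (hβ1 : β < 1) (a₁ a₂ r₁ r₂ : ℝ)
    {t : ℝ} (ht : 0 < t) :
    caputoDeriv β (fun t => a₁ * mittagLeffler β (r₁ * t ^ β) +
      a₂ * mittagLeffler β (r₂ * t ^ β)) t =
      a₁ * r₁ * mittagLeffler β (r₁ * t ^ β) + a₂ * r₂ * mittagLeffler β (r₂ * t ^ β) := by
  rw [((caputoDifferentiable_mittagLeffler_rpow hβ r₁ hβ hβ1).linearCombination hβ hβ1
    (caputoDifferentiable_mittagLeffler_rpow hβ r₂ hβ hβ1) a₁ a₂).2 t ht,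
    caputoDeriv_self_mittagLeffler_rpow hβ hβ1 _ ht,
    caputoDeriv_self_mittagLeffler_rpow hβ hβ1 _ ht]
  ring

theorem caputoDeriv_two_mul_mittagLeffler_combination (hβ : 0 < β) (hβ1 : β < 1 / 2)
    {a₁ a₂ r₁ r₂ : ℝ} (h : a₁ * r₁ + a₂ * r₂ = 0) {t : ℝ} (ht : 0 < t) :
    caputoDeriv (2 * β) (fun t => a₁ * mittagLeffler β (r₁ * t ^ β) +
      a₂ * mittagLeffler β (r₂ * t ^ β)) t =
      a₁ * r₁ ^ 2 * mittagLeffler β (r₁ * t ^ β) +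
        a₂ * r₂ ^ 2 * mittagLeffler β (r₂ * t ^ β) := by
  have h0 : 0 < 2 * β := by linarith
  have h1 : 2 * β < 1 := by linarith
  rw [((caputoDifferentiable_mittagLeffler_rpow hβ r₁ h0 h1).linearCombination h0 h1
    (caputoDifferentiable_mittagLeffler_rpow hβ r₂ h0 h1) a₁ a₂).2 t ht,
    caputoDeriv_two_mul_mittagLeffler_rpow hβ hβ1 _ ht,
    caputoDeriv_two_mul_mittagLeffler_rpow hβ hβ1 _ ht]
  linear_combination (t ^ (-β) / Real.Gamma (1 - β)) * h

/-- Each summand is an eigenfunction of `D^β`, so iteration produces no singular term and the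
coefficients are unrestricted, in contrast to order `2β`. -/
theorem seqCaputoDeriv_two_mittagLeffler_combination (hβ : 0 < β) (hβ1 : β < 1)
    (a₁ a₂ r₁ r₂ : ℝ) {t : ℝ} (ht : 0 < t) :
    seqCaputoDeriv β 2 (fun t => a₁ * mittagLeffler β (r₁ * t ^ β) +
      a₂ * mittagLeffler β (r₂ * t ^ β)) t =
      a₁ * r₁ ^ 2 * mittagLeffler β (r₁ * t ^ β) +
        a₂ * r₂ ^ 2 * mittagLeffler β (r₂ * t ^ β) := by
  rw [seqCaputoDeriv_two, caputoDeriv_congr_Ioi hβ hβ1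
    (fun t ht => caputoDeriv_mittagLeffler_combination hβ hβ1 a₁ a₂ r₁ r₂ ht) t ht,
    caputoDeriv_mittagLeffler_combination hβ hβ1 _ _ _ _ ht]
  ring

theorem continuous_mittagLeffler_combination (hβ : 0 < β) (a₁ a₂ r₁ r₂ : ℝ) :
    Continuous fun t : ℝ => a₁ * mittagLeffler β (r₁ * t ^ β) +
      a₂ * mittagLeffler β (r₂ * t ^ β) :=
  ((continuous_mittagLeffler_rpow hβ r₁).const_mul a₁).add
    ((continuous_mittagLeffler_rpow hβ r₂).const_mul a₂)

theorem tendsto_seqCaputoDeriv_one_mittagLeffler_combination (hβ : 0 < β) (hβ1 : β < 1)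
    (a₁ a₂ r₁ r₂ : ℝ) :
    Tendsto (seqCaputoDeriv β 1 fun t => a₁ * mittagLeffler β (r₁ * t ^ β) +
      a₂ * mittagLeffler β (r₂ * t ^ β)) (𝓝[>] 0) (𝓝 (a₁ * r₁ + a₂ * r₂)) := by
  have h := (continuous_mittagLeffler_combination hβ (a₁ * r₁) (a₂ * r₂) r₁ r₂).tendsto 0
  simp only [Real.zero_rpow hβ.ne', mul_zero, mittagLeffler_zero, mul_one] at h
  refine (h.mono_left nhdsWithin_le_nhds).congr' ?_
  filter_upwards [self_mem_nhdsWithin] with t ht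
  exact (caputoDeriv_mittagLeffler_combination hβ hβ1 a₁ a₂ r₁ r₂ ht).symm

theorem isCaputoSolution_mittagLeffler_combination (hβ : 0 < β) (hβ1 : β < 1 / 2)
    {μ γ a₁ a₂ r₁ r₂ : ℝ} (h₁ : r₁ ^ 2 + 2 * μ * r₁ + γ = 0) (h₂ : r₂ ^ 2 + 2 * μ * r₂ + γ = 0)
    (h : a₁ * r₁ + a₂ * r₂ = 0) (ha : a₁ + a₂ = 1) :
    IsCaputoSolution β μ γ fun t => a₁ * mittagLeffler β (r₁ * t ^ β) +
      a₂ * mittagLeffler β (r₂ * t ^ β) := by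
  have h0 : 0 < 2 * β := by linarith
  have h1 : 2 * β < 1 := by linarith
  have hβ2 : β < 1 := by linarith
  refine ⟨(continuous_mittagLeffler_combination hβ a₁ a₂ r₁ r₂).continuousOn,
    ((caputoDifferentiable_mittagLeffler_rpow hβ r₁ hβ hβ2).linearCombination hβ hβ2
      (caputoDifferentiable_mittagLeffler_rpow hβ r₂ hβ hβ2) a₁ a₂).1,
    ((caputoDifferentiable_mittagLeffler_rpow hβ r₁ h0 h1).linearCombination h0 h1
      (caputoDifferentiable_mittagLeffler_rpow hβ r₂ h0 h1) a₁ a₂).1, fun t ht => ?_, ?_⟩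
  · rw [caputoDeriv_mittagLeffler_combination hβ hβ2 _ _ _ _ ht,
      caputoDeriv_two_mul_mittagLeffler_combination hβ hβ1 h ht]
    linear_combination a₁ * mittagLeffler β (r₁ * t ^ β) * h₁ +
      a₂ * mittagLeffler β (r₂ * t ^ β) * h₂
  · simp only [Real.zero_rpow hβ.ne', mul_zero, mittagLeffler_zero, mul_one, ha]

theorem isSequentialSolution_mittagLeffler_combination (hβ : 0 < β) (hβ1 : β < 1 / 2)
    {μ γ a₁ a₂ r₁ r₂ : ℝ} (h₁ : r₁ ^ 2 + 2 * μ * r₁ + γ = 0) (h₂ : r₂ ^ 2 + 2 * μ * r₂ + γ = 0)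
    (ha : a₁ + a₂ = 1) :
    IsSequentialSolution β μ γ (a₁ * r₁ + a₂ * r₂) fun t =>
      a₁ * mittagLeffler β (r₁ * t ^ β) + a₂ * mittagLeffler β (r₂ * t ^ β) := by
  have hβ2 : β < 1 := by linarith
  have hd := fun a b : ℝ =>
    ((caputoDifferentiable_mittagLeffler_rpow hβ r₁ hβ hβ2).linearCombination hβ hβ2
      (caputoDifferentiable_mittagLeffler_rpow hβ r₂ hβ hβ2) a b).1
  refine ⟨(continuous_mittagLeffler_combination hβ a₁ a₂ r₁ r₂).continuousOn, hd a₁ a₂,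
    (hd (a₁ * r₁) (a₂ * r₂)).congr_Ioi hβ hβ2 fun t ht =>
      (caputoDeriv_mittagLeffler_combination hβ hβ2 a₁ a₂ r₁ r₂ ht).symm, fun t ht => ?_, ?_,
    tendsto_seqCaputoDeriv_one_mittagLeffler_combination hβ hβ2 a₁ a₂ r₁ r₂⟩
  · rw [seqCaputoDeriv_one, caputoDeriv_mittagLeffler_combination hβ hβ2 _ _ _ _ ht,
      seqCaputoDeriv_two_mittagLeffler_combination hβ hβ2 _ _ _ _ ht]
    linear_combination a₁ * mittagLeffler β (r₁ * t ^ β) * h₁ +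
      a₂ * mittagLeffler β (r₂ * t ^ β) * h₂
  · simp only [Real.zero_rpow hβ.ne', mul_zero, mittagLeffler_zero, mul_one, ha]

end Combination

/-! ### Uniqueness for the two initial value problems -/

theorem abs_fracInt_le {a t : ℝ} (ha : 0 < a) (ht : 0 ≤ t) (f : ℝ → ℝ) :
    |fracInt a f t| ≤ 1 / Real.Gamma a * ∫ s in (0 : ℝ)..t, (t - s) ^ (a - 1) * |f s| := by
  have hG := Real.Gamma_pos_of_pos ha
  rw [fracInt, abs_mul, abs_of_pos (by positivity : 0 < 1 / Real.Gamma a)]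
  refine mul_le_mul_of_nonneg_left ?_ (by positivity)
  refine (intervalIntegral.abs_integral_le_integral_abs ht).trans_eq ?_
  rw [intervalIntegral.integral_of_le ht, intervalIntegral.integral_of_le ht]
  refine setIntegral_congr_fun measurableSet_Ioc fun s hs => ?_
  have : 0 ≤ t - s := sub_nonneg.2 hs.2
  rw [abs_mul, abs_of_nonneg (by positivity : 0 ≤ (t - s) ^ (a - 1))]

theorem intervalIntegrable_sub_rpow_mul {a t : ℝ} (ha : 0 < a) (ht : 0 < t) {f : ℝ → ℝ}
    (hf : ContinuousOn f (Ici 0)) :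
    IntervalIntegrable (fun s => (t - s) ^ (a - 1) * f s) volume 0 t := by
  refine (intervalIntegrable_sub_rpow ha ht).mul_continuousOn (hf.mono ?_)
  rw [uIcc_of_le ht.le]
  exact Icc_subset_Ici_self

theorem fracInt_sub {a t : ℝ} {f g : ℝ → ℝ}
    (hf : IntervalIntegrable (fun s => (t - s) ^ (a - 1) * f s) volume 0 t)
    (hg : IntervalIntegrable (fun s => (t - s) ^ (a - 1) * g s) volume 0 t) :
    fracInt a (fun s => f s - g s) t = fracInt a f t - fracInt a g t := by
  simp only [fracInt, mul_sub]
  rw [intervalIntegral.integral_sub hf hg, mul_sub]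

/-- Applies `I^a` to an equation valid on `(0, t]`. Integrability against the kernel is asked of
each term, since fractional derivatives of a solution need not be bounded near `0`. -/
theorem fracInt_linear_eq_zero {a t c d : ℝ} (ht : 0 ≤ t) {f g h : ℝ → ℝ}
    (hf : IntervalIntegrable (fun s => (t - s) ^ (a - 1) * f s) volume 0 t)
    (hg : IntervalIntegrable (fun s => (t - s) ^ (a - 1) * g s) volume 0 t)
    (hh : IntervalIntegrable (fun s => (t - s) ^ (a - 1) * h s) volume 0 t)
    (h0 : ∀ s ∈ Ioc 0 t, f s + c * g s + d * h s = 0) :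
    fracInt a f t + c * fracInt a g t + d * fracInt a h t = 0 := by
  have h1 : fracInt a (fun s => f s + c * g s + d * h s) t = 0 := by
    rw [fracInt_congr (g := fun _ => 0) ht h0]
    simp [fracInt]
  rw [← h1]
  simp only [fracInt]
  have : ∀ s, (t - s) ^ (a - 1) * (f s + c * g s + d * h s) = (t - s) ^ (a - 1) * f s +
      c * ((t - s) ^ (a - 1) * g s) + d * ((t - s) ^ (a - 1) * h s) := fun s => by ring
  simp only [this]
  rw [intervalIntegral.integral_add (hf.add (hg.const_mul c)) (hh.const_mul d),
    intervalIntegral.integral_add hf (hg.const_mul c), intervalIntegral.integral_const_mul,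
    intervalIntegral.integral_const_mul]
  ring

theorem tendsto_nhdsGT_of_continuousOn {u : ℝ → ℝ} (h : ContinuousOn u (Ici 0)) :
    Tendsto u (𝓝[>] 0) (𝓝 (u 0)) :=
  (h 0 self_mem_Ici).tendsto.mono_left (nhdsWithin_mono _ Ioi_subset_Ici_self)

theorem exists_abs_le_of_continuousOn {u : ℝ → ℝ} (h : ContinuousOn u (Ici 0)) (T : ℝ) :
    ∃ B, ∀ t ∈ Ioc 0 T, |u t| ≤ B := by
  obtain ⟨B, hB⟩ := isCompact_Icc.exists_bound_of_continuousOn (h.mono Icc_subset_Ici_self)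
  exact ⟨B, fun t ht => hB t (Ioc_subset_Icc_self ht)⟩

/-- The Volterra equation equivalent to the Caputo problem. -/
theorem IsCaputoSolution.volterra {β μ γ : ℝ} (hβ : 0 < β) (hβ1 : β < 1 / 2) {u : ℝ → ℝ}
    (hu : IsCaputoSolution β μ γ u) {t : ℝ} (ht : 0 < t) :
    u t - 1 + 2 * μ * fracInt β (fun s => u s - 1) t + γ * fracInt (2 * β) u t = 0 := by
  have hv := hu.differentiable_beta.intervalIntegrable_deriv hβ (by linarith) ht
  have hFTC : ∀ s, 0 < s → u s - 1 = fracInt 1 (deriv u) s := fun s hs => by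
    have h := tendsto_nhdsGT_of_continuousOn hu.continuousOn
    rw [hu.initial] at h
    rw [hu.differentiable_beta.eq_add_fracInt_one hβ (by linarith) h hs]
    ring
  -- Applying `I^{2β}` to the equation: `I^{2β} D^{2β} u = I^1 u' = u - 1` and `I^{2β} D^β u =
  -- I^{β+1} u' = I^β (u - 1)`.
  obtain ⟨i1, e1⟩ := fracInt_fracInt (a := 2 * β) (b := 1 - 2 * β) (by linarith) (by linarith)
    (by linarith) ht hv
  obtain ⟨i2, e2⟩ := fracInt_fracInt (a := 2 * β) (b := 1 - β) (by linarith) (by linarith)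
    (by linarith) ht hv
  obtain ⟨-, e3⟩ := fracInt_fracInt (a := β) (b := 1) hβ one_pos (by linarith) ht hv
  have key := fracInt_linear_eq_zero (c := 2 * μ) (d := γ) ht.le i1 i2
    (intervalIntegrable_sub_rpow_mul (by linarith) ht hu.continuousOn) fun s hs => by
      have := hu.equation s hs.1
      rwa [caputoDeriv_eq_fracInt (by linarith) (by linarith),
        caputoDeriv_eq_fracInt hβ (by linarith)] at this
  rw [e1, e2, show 2 * β + (1 - β) = β + 1 by ring, ← e3, add_sub_cancel, ← hFTC t ht] at key
  rwa [fracInt_congr ht.le fun s hs => hFTC s hs.1]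

theorem IsCaputoSolution.unique {β μ γ : ℝ} (hβ : 0 < β) (hβ1 : β < 1 / 2) (hμ : 0 ≤ μ)
    (hγ : 0 ≤ γ) {u w : ℝ → ℝ} (hu : IsCaputoSolution β μ γ u) (hw : IsCaputoSolution β μ γ w)
    {t : ℝ} (ht : 0 ≤ t) : u t = w t := by
  rcases ht.eq_or_lt with rfl | ht
  · rw [hu.initial, hw.initial]
  have hcont : ContinuousOn (fun s => u s - w s) (Ici 0) := hu.continuousOn.sub hw.continuousOn
  obtain ⟨B, hB⟩ := exists_abs_le_of_continuousOn hcont t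
  have hG1 := Real.Gamma_pos_of_pos hβ
  have hG2 := Real.Gamma_pos_of_pos (by linarith : 0 < 2 * β)
  refine sub_eq_zero.1 (eq_zero_of_abs_le_integral_sub_rpow_mul hβ
    (C := 2 * μ / Real.Gamma β + γ * t ^ β / Real.Gamma (2 * β)) (by positivity)
    hB (fun s hs => ?_) t ⟨ht, le_rfl⟩)
  have i1 := fun {a : ℝ} (ha : 0 < a) => intervalIntegrable_sub_rpow_mul ha hs.1 hu.continuousOn
  have i2 := fun {a : ℝ} (ha : 0 < a) => intervalIntegrable_sub_rpow_mul ha hs.1 hw.continuousOn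
  have i3 := fun {a : ℝ} (ha : 0 < a) => intervalIntegrable_sub_rpow_mul ha hs.1
    (hu.continuousOn.sub continuousOn_const : ContinuousOn (fun s => u s - 1) (Ici 0))
  have i4 := fun {a : ℝ} (ha : 0 < a) => intervalIntegrable_sub_rpow_mul ha hs.1
    (hw.continuousOn.sub continuousOn_const : ContinuousOn (fun s => w s - 1) (Ici 0))
  have e1 := fracInt_sub (f := fun s => u s - 1) (g := fun s => w s - 1) (i3 hβ) (i4 hβ)
  simp only [sub_sub_sub_cancel_right] at e1
  have e2 := fracInt_sub (i1 (by linarith : 0 < 2 * β)) (i2 (by linarith))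
  have key : u s - w s = -(2 * μ * fracInt β (fun s => u s - w s) s +
      γ * fracInt (2 * β) (fun s => u s - w s) s) := by
    rw [e1, e2]
    linear_combination hu.volterra hβ hβ1 hs.1 - hw.volterra hβ hβ1 hs.1
  set I := ∫ x in (0 : ℝ)..s, (s - x) ^ (β - 1) * |u x - w x| with hI
  have b1 := abs_fracInt_le hβ hs.1.le fun s => u s - w s
  have b2 := abs_fracInt_le (by linarith : 0 < 2 * β) hs.1.le fun s => u s - w s
  -- The kernel of order `2β` is the kernel of order `β` times `(s - x)^β ≤ t^β`, so one Grönwall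
  -- inequality with exponent `β` covers both terms.
  have b3 : ∫ x in (0 : ℝ)..s, (s - x) ^ (2 * β - 1) * |u x - w x| ≤ t ^ β * I := by
    rw [hI, ← intervalIntegral.integral_const_mul]
    refine intervalIntegral.integral_mono_on_of_le_Ioo hs.1.le
      (intervalIntegrable_sub_rpow_mul (by linarith) hs.1 hcont.abs)
      ((intervalIntegrable_sub_rpow_mul hβ hs.1 hcont.abs).const_mul _) fun x hx => ?_
    have h1 : 0 < s - x := sub_pos.2 hx.2
    rw [show 2 * β - 1 = β + (β - 1) by ring, Real.rpow_add h1, mul_assoc]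
    have : s - x ≤ t := by linarith [hx.1, hs.2]
    gcongr
  calc |u s - w s| ≤ 2 * μ * |fracInt β (fun s => u s - w s) s| +
        γ * |fracInt (2 * β) (fun s => u s - w s) s| := by
        conv_lhs => rw [key]
        rw [abs_neg]
        refine (abs_add_le _ _).trans_eq ?_
        rw [abs_mul, abs_mul γ, abs_of_nonneg (by positivity : 0 ≤ 2 * μ), abs_of_nonneg hγ]
    _ ≤ 2 * μ * (1 / Real.Gamma β * I) + γ * (1 / Real.Gamma (2 * β) * (t ^ β * I)) := by
        gcongr
        exact b2.trans (by gcongr)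
    _ = (2 * μ / Real.Gamma β + γ * t ^ β / Real.Gamma (2 * β)) * I := by ring

/-- The Volterra system equivalent to the sequential problem with `𝒟^β u(0) = 0`. -/
theorem IsSequentialSolution.volterra {β μ γ : ℝ} (hβ : 0 < β) (hβ1 : β < 1) {u : ℝ → ℝ}
    (hu : IsSequentialSolution β μ γ 0 u) {t : ℝ} (ht : 0 < t) :
    IntervalIntegrable (fun s => (t - s) ^ (β - 1) * caputoDeriv β u s) volume 0 t ∧
      u t = 1 + fracInt β (caputoDeriv β u) t ∧
      caputoDeriv β u t = fracInt 1 (deriv (caputoDeriv β u)) t ∧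
      caputoDeriv β u t + 2 * μ * fracInt β (caputoDeriv β u) t + γ * fracInt β u t = 0 := by
  have hv := hu.differentiable.intervalIntegrable_deriv hβ hβ1 ht
  have hV := hu.differentiable_deriv
  have hVi := hu.initial_deriv
  rw [seqCaputoDeriv_one] at hV hVi
  have hV' := hV.intervalIntegrable_deriv hβ hβ1 ht
  have hu0 := tendsto_nhdsGT_of_continuousOn hu.continuousOn
  rw [hu.initial] at hu0
  have hFu := hu.differentiable.eq_add_fracInt_one hβ hβ1 hu0 ht
  have hFV := hV.eq_add_fracInt_one hβ hβ1 hVi ht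
  rw [zero_add] at hFV
  -- `I^β` inverts `D^β` up to the initial value: it sends `D^β u` to `u - 1`, and `D^β D^β u` to
  -- `D^β u` because `D^β u` tends to `0` at `0+`.
  obtain ⟨i1, e1⟩ := fracInt_fracInt (a := β) (b := 1 - β) hβ (by linarith)
    (by linarith) ht hv
  obtain ⟨i2, e2⟩ := fracInt_fracInt (a := β) (b := 1 - β) hβ (by linarith)
    (by linarith) ht hV'
  have hcd : caputoDeriv β u = fracInt (1 - β) (deriv u) :=
    funext fun s => caputoDeriv_eq_fracInt hβ hβ1 u s
  rw [← hcd] at i1 e1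
  rw [add_sub_cancel] at e1 e2
  refine ⟨i1, by rw [e1, hFu], hFV, ?_⟩
  have key := fracInt_linear_eq_zero (c := 2 * μ) (d := γ) ht.le i2 i1
    (intervalIntegrable_sub_rpow_mul hβ ht hu.continuousOn) fun s hs => by
      have := hu.equation s hs.1
      rwa [seqCaputoDeriv_two, seqCaputoDeriv_one,
        caputoDeriv_eq_fracInt hβ hβ1 (caputoDeriv β u)] at this
  rwa [e2, ← hFV] at key

theorem abs_fracInt_one_le {f : ℝ → ℝ} {s t : ℝ} (hs : s ∈ Ioc 0 t)
    (hf : IntervalIntegrable f volume 0 t) : |fracInt 1 f s| ≤ ∫ x in (0 : ℝ)..t, |f x| := by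
  rw [fracInt_one_apply]
  refine (intervalIntegral.abs_integral_le_integral_abs hs.1.le).trans ?_
  refine intervalIntegral.integral_mono_interval le_rfl hs.1.le hs.2 ?_ hf.abs
  exact Eventually.of_forall fun x => abs_nonneg _

theorem IsSequentialSolution.unique {β μ γ : ℝ} (hβ : 0 < β) (hβ1 : β < 1) (hμ : 0 ≤ μ)
    (hγ : 0 ≤ γ) {u w : ℝ → ℝ} (hu : IsSequentialSolution β μ γ 0 u)
    (hw : IsSequentialSolution β μ γ 0 w) {t : ℝ} (ht : 0 ≤ t) : u t = w t := by
  rcases ht.eq_or_lt with rfl | ht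
  · rw [hu.initial, hw.initial]
  have hcont : ContinuousOn (fun s => u s - w s) (Ici 0) := hu.continuousOn.sub hw.continuousOn
  obtain ⟨B, hB⟩ := exists_abs_le_of_continuousOn hcont t
  have hVu := hu.differentiable_deriv.intervalIntegrable_deriv hβ hβ1 ht
  have hVw := hw.differentiable_deriv.intervalIntegrable_deriv hβ hβ1 ht
  rw [seqCaputoDeriv_one] at hVu hVw
  set V := caputoDeriv β u with hV
  set W := caputoDeriv β w with hW
  have hG := Real.Gamma_pos_of_pos hβ
  -- Grönwall is applied to the sum of both components of the system. The bound `B` works because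
  -- `V` and `W` are primitives, vanishing at `0+`, of integrable derivatives.
  have hzero := eq_zero_of_abs_le_integral_sub_rpow_mul hβ
    (f := fun s => |u s - w s| + |V s - W s|) (T := t)
    (B := B + (∫ x in (0 : ℝ)..t, |deriv V x|) + ∫ x in (0 : ℝ)..t, |deriv W x|)
    (C := (1 + 2 * μ + γ) / Real.Gamma β) (by positivity) (fun s hs => ?_) (fun s hs => ?_) t
    ⟨ht, le_rfl⟩
  · have h1 := abs_nonneg (u t - w t)
    have h2 := abs_nonneg (V t - W t)
    exact sub_eq_zero.1 (abs_eq_zero.1 (by linarith))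
  · have h1 := abs_fracInt_one_le hs hVu
    have h2 := abs_fracInt_one_le hs hVw
    rw [← (hu.volterra hβ hβ1 hs.1).2.2.1] at h1
    rw [← (hw.volterra hβ hβ1 hs.1).2.2.1] at h2
    rw [abs_of_nonneg (by positivity)]
    have := abs_sub (V s) (W s)
    linarith [hB s hs]
  · obtain ⟨iV, hu1, -, hu2⟩ := hu.volterra hβ hβ1 hs.1
    obtain ⟨iW, hw1, -, hw2⟩ := hw.volterra hβ hβ1 hs.1
    have iu := intervalIntegrable_sub_rpow_mul hβ hs.1 hu.continuousOn
    have iw := intervalIntegrable_sub_rpow_mul hβ hs.1 hw.continuousOn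
    have e1 := fracInt_sub iu iw
    have e2 := fracInt_sub iV iW
    have k1 : u s - w s = fracInt β (fun s => V s - W s) s := by
      rw [e2]; linear_combination hu1 - hw1
    have k2 : V s - W s = -(2 * μ * fracInt β (fun s => V s - W s) s +
        γ * fracInt β (fun s => u s - w s) s) := by
      rw [e1, e2]; linear_combination hu2 - hw2
    have iabs : ∀ {f g : ℝ → ℝ},
        IntervalIntegrable (fun x => (s - x) ^ (β - 1) * f x) volume 0 s →
        IntervalIntegrable (fun x => (s - x) ^ (β - 1) * g x) volume 0 s →
        IntervalIntegrable (fun x => (s - x) ^ (β - 1) * |f x - g x|) volume 0 s := by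
      intro f g hf hg
      refine (hf.sub hg).abs.congr_Ioc hs.1.le fun x hx => ?_
      have : 0 ≤ s - x := sub_nonneg.2 hx.2
      rw [← mul_sub, abs_mul, abs_of_nonneg (by positivity : 0 ≤ (s - x) ^ (β - 1))]
    set Iu := ∫ x in (0 : ℝ)..s, (s - x) ^ (β - 1) * |u x - w x| with hIu
    set IV := ∫ x in (0 : ℝ)..s, (s - x) ^ (β - 1) * |V x - W x| with hIV
    have hI : ∫ x in (0 : ℝ)..s, (s - x) ^ (β - 1) * |(|u x - w x| + |V x - W x|)| =
        Iu + IV := by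
      rw [hIu, hIV, ← intervalIntegral.integral_add (iabs iu iw) (iabs iV iW)]
      refine intervalIntegral.integral_congr fun x _ => ?_
      rw [abs_of_nonneg (by positivity), mul_add]
    have b1 := abs_fracInt_le hβ hs.1.le fun s => u s - w s
    have b2 := abs_fracInt_le hβ hs.1.le fun s => V s - W s
    have hnn : ∀ f : ℝ → ℝ, 0 ≤ ∫ x in (0 : ℝ)..s, (s - x) ^ (β - 1) * |f x| := fun f => by
      refine intervalIntegral.integral_nonneg hs.1.le fun x hx => ?_
      have : 0 ≤ s - x := sub_nonneg.2 hx.2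
      positivity
    have hIu0 : 0 ≤ Iu := hnn _
    have hIV0 : 0 ≤ IV := hnn _
    have c1 : |u s - w s| ≤ 1 / Real.Gamma β * IV := by rw [k1]; exact b2
    have c2 : |V s - W s| ≤ 2 * μ * (1 / Real.Gamma β * IV) + γ * (1 / Real.Gamma β * Iu) := by
      rw [k2, abs_neg]
      refine (abs_add_le _ _).trans ?_
      rw [abs_mul, abs_mul γ, abs_of_nonneg (by positivity : 0 ≤ 2 * μ), abs_of_nonneg hγ]
      gcongr
    rw [hI, abs_of_nonneg (by positivity)]
    have : (1 + 2 * μ + γ) / Real.Gamma β * (Iu + IV) = 1 / Real.Gamma β * IV +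
        (2 * μ * (1 / Real.Gamma β * IV) + γ * (1 / Real.Gamma β * Iu)) +
        (1 + 2 * μ) * (1 / Real.Gamma β * Iu) + γ * (1 / Real.Gamma β * IV) := by
      ring
    rw [this]
    have p1 : 0 ≤ (1 + 2 * μ) * (1 / Real.Gamma β * Iu) := by positivity
    have p2 : 0 ≤ γ * (1 / Real.Gamma β * IV) := by positivity
    linarith

/-! ### The exponential form of the Gamma integral -/

/-- Euler's integral under `x = exp u`. In this coordinate powers become entire exponentials and no
branch of the logarithm is needed on the Hankel contour. -/
theorem integrable_exp_neg_exp_mul_exp {c : ℝ} (hc : 0 < c) :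
    Integrable fun u : ℝ => Real.exp (-Real.exp u) * Real.exp (c * u) := by
  have h := (integrableOn_image_iff_integrableOn_abs_deriv_smul MeasurableSet.univ
    (fun x _ => (Real.hasDerivAt_exp x).hasDerivWithinAt) Real.exp_injective.injOn
    (fun x => Real.exp (-x) * x ^ (c - 1))).1
    (by rw [image_univ, Real.range_exp]; exact Real.GammaIntegral_convergent hc)
  rw [integrableOn_univ] at h
  refine h.congr (Eventually.of_forall fun u => ?_)
  simp only [smul_eq_mul]
  rw [abs_of_pos (Real.exp_pos u), ← Real.exp_mul, ← Real.exp_add, ← Real.exp_add, ← Real.exp_add]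
  ring_nf

theorem integral_exp_neg_exp_mul_exp {c : ℝ} (hc : 0 < c) :
    ∫ u : ℝ, Real.exp (-Real.exp u) * Real.exp (c * u) = Real.Gamma c := by
  have h := integral_image_eq_integral_abs_deriv_smul MeasurableSet.univ
    (fun x _ => (Real.hasDerivAt_exp x).hasDerivWithinAt) Real.exp_injective.injOn
    (fun x => Real.exp (-x) * x ^ (c - 1))
  rw [image_univ, Real.range_exp, ← Real.Gamma_eq_integral hc, setIntegral_univ] at h
  rw [h]
  congr 1
  ext u
  simp only [smul_eq_mul]
  rw [abs_of_pos (Real.exp_pos u), ← Real.exp_mul, ← Real.exp_add, ← Real.exp_add, ← Real.exp_add]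
  ring_nf

/-- To the right, the double exponential beats any `c`; positivity of `c` matters only at `-∞`. The
comparison exponent is `max c 1`. -/
theorem integrableOn_Ioi_exp_neg_exp_mul_exp (a c : ℝ) :
    IntegrableOn (fun u : ℝ => Real.exp (-Real.exp u) * Real.exp (c * u)) (Ioi a) := by
  have h1 := (integrable_exp_neg_exp_mul_exp
    (c := max c 1) (by positivity)).integrableOn (s := Ioi a)
  refine (h1.mul_const (Real.exp ((c - max c 1) * a))).mono'
    (Continuous.aestronglyMeasurable (by fun_prop)) ?_
  filter_upwards [ae_restrict_mem measurableSet_Ioi] with u hu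
  have hu' : a < u := hu
  rw [Real.norm_of_nonneg (by positivity), mul_assoc]
  refine mul_le_mul_of_nonneg_left ?_ (Real.exp_pos _).le
  rw [← Real.exp_add, Real.exp_le_exp]
  have : c - max c 1 ≤ 0 := sub_nonpos.2 (le_max_left _ _)
  nlinarith

/-! ### Hankel integrals in the logarithmic coordinate -/

open Complex in
/-- The integral of `F` along the image, in the coordinate `w = log ζ`, of a Hankel contour that
runs along the two sides of the negative axis and the circle of radius `exp a`. -/
noncomputable def hankelIntegral (a : ℝ) (F : ℂ → ℂ) : ℂ :=
  I * (∫ y in (-Real.pi)..Real.pi, F (a + y * I)) +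
    ((∫ u in Ioi a, F (u + (Real.pi : ℝ) * I)) - ∫ u in Ioi a, F (u + ((-Real.pi : ℝ) : ℂ) * I))

open Complex in
/-- Cauchy's theorem on a half-strip, for functions that decay to the left. -/
theorem integral_vertical_eq_of_exp_decay {F : ℂ → ℂ} {a b c K : ℝ} (hc : 0 < c) (hb : 0 ≤ b)
    (hd : ∀ w : ℂ, |w.im| ≤ b → DifferentiableAt ℂ F w)
    (hK : ∀ w : ℂ, |w.im| ≤ b → w.re ≤ a → ‖F w‖ ≤ K * Real.exp (c * w.re)) :
    (∀ θ : ℝ, |θ| ≤ b → IntegrableOn (fun u : ℝ => F (u + (θ : ℂ) * I)) (Iic a)) ∧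
    I * (∫ y in (-b)..b, F (a + y * I)) =
      (∫ u in Iic a, F (u + (b : ℂ) * I)) - ∫ u in Iic a, F (u + ((-b : ℝ) : ℂ) * I) := by
  have hint : ∀ θ : ℝ, |θ| ≤ b → IntegrableOn (fun u : ℝ => F (u + (θ : ℂ) * I)) (Iic a) := by
    intro θ hθ
    have hcont : Continuous fun u : ℝ => F (u + (θ : ℂ) * I) := by
      refine continuous_iff_continuousAt.2 fun u => ?_
      have h1 : ContinuousAt F (u + (θ : ℂ) * I) := (hd _ (by simpa using hθ)).continuousAt
      exact ContinuousAt.comp (f := fun u : ℝ => (u : ℂ) + (θ : ℂ) * I) h1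
        (Continuous.continuousAt (by fun_prop))
    refine Integrable.mono' ((integrableOn_exp_mul_Iic hc a).const_mul K)
      hcont.aestronglyMeasurable ?_
    filter_upwards [ae_restrict_mem measurableSet_Iic] with u hu
    have := hK (u + (θ : ℂ) * I) (by simpa using hθ) (by simpa using hu)
    simpa using this
  refine ⟨hint, ?_⟩
  -- Cauchy's theorem on the rectangle `[-n, a] × [-b, b]`; the left edge vanishes as `n → ∞` by the
  -- exponential decay.
  have hrect : ∀ n : ℕ, -(n : ℝ) ≤ a →
      (∫ x : ℝ in (-(n : ℝ))..a, F (x + ((-b : ℝ) : ℂ) * I)) -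
        (∫ x : ℝ in (-(n : ℝ))..a, F (x + (b : ℂ) * I)) +
        I * (∫ y : ℝ in (-b)..b, F (a + y * I)) =
        I * (∫ y : ℝ in (-b)..b, F ((-(n : ℝ) : ℝ) + y * I)) := by
    intro n hn
    have h := integral_boundary_rect_eq_zero_of_differentiableOn F ⟨-(n : ℝ), -b⟩ ⟨a, b⟩
      (fun w hw => (hd w (by
        have h2 := hw.2
        simp only [mem_preimage] at h2
        rw [uIcc_of_le (by linarith : -b ≤ b)] at h2
        exact abs_le.2 h2)).differentiableWithinAt)
    simp only [smul_eq_mul] at h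
    exact sub_eq_zero.1 h
  have hleft : Tendsto (fun n : ℕ => I * (∫ y : ℝ in (-b)..b, F ((-(n : ℝ) : ℝ) + y * I)))
      atTop (𝓝 0) := by
    have hz : Tendsto (fun n : ℕ => K * Real.exp (c * -(n : ℝ)) * |b - -b|) atTop (𝓝 0) := by
      have h1 : Tendsto (fun n : ℕ => c * -(n : ℝ)) atTop atBot :=
        (tendsto_neg_atTop_atBot.comp tendsto_natCast_atTop_atTop).const_mul_atBot hc
      have := ((Real.tendsto_exp_atBot.comp h1).const_mul K).mul_const |b - -b|
      simpa using this
    refine squeeze_zero_norm' ?_ hz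
    filter_upwards [eventually_ge_atTop ⌈-a⌉₊] with n hn
    have hn' : -(n : ℝ) ≤ a := by
      have := (Nat.le_ceil (-a)).trans (Nat.cast_le.2 hn)
      linarith
    rw [norm_mul, norm_I, one_mul]
    refine intervalIntegral.norm_integral_le_of_norm_le_const fun y hy => ?_
    rw [uIoc_of_le (by linarith : -b ≤ b)] at hy
    have := hK ((-(n : ℝ) : ℝ) + y * I) (by simpa using abs_le.2 ⟨hy.1.le, hy.2⟩)
      (by simpa using hn')
    simpa using this
  have hbot : Tendsto (fun n : ℕ => -(n : ℝ)) atTop atBot :=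
    tendsto_neg_atTop_atBot.comp tendsto_natCast_atTop_atTop
  have h1 := intervalIntegral_tendsto_integral_Iic a (hint (-b) (by simp [abs_of_nonneg hb])) hbot
  have h2 := intervalIntegral_tendsto_integral_Iic a (hint b (by simp [abs_of_nonneg hb])) hbot
  have h3 := (h1.sub h2).add_const (I * (∫ y : ℝ in (-b)..b, F (a + y * I)))
  have h4 := tendsto_nhds_unique (hleft.congr' ?_) h3
  · linear_combination -h4
  · filter_upwards [eventually_ge_atTop ⌈-a⌉₊] with n hn
    have hn' : -(n : ℝ) ≤ a := by
      have := (Nat.le_ceil (-a)).trans (Nat.cast_le.2 hn)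
      linarith
    exact (hrect n hn').symm

/-- Deformation of the Hankel contour onto the two sides of the negative axis. -/
theorem hankelIntegral_eq_of_exp_decay {F : ℂ → ℂ} {a c K : ℝ} (hc : 0 < c)
    (hd : ∀ w : ℂ, |w.im| ≤ Real.pi → DifferentiableAt ℂ F w)
    (hK : ∀ w : ℂ, |w.im| ≤ Real.pi → w.re ≤ a → ‖F w‖ ≤ K * Real.exp (c * w.re))
    (h1 : IntegrableOn (fun u : ℝ => F (u + (Real.pi : ℂ) * Complex.I)) (Ioi a))
    (h2 : IntegrableOn (fun u : ℝ => F (u + ((-Real.pi : ℝ) : ℂ) * Complex.I)) (Ioi a)) :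
    hankelIntegral a F = (∫ u : ℝ, F (u + (Real.pi : ℂ) * Complex.I)) -
      ∫ u : ℝ, F (u + ((-Real.pi : ℝ) : ℂ) * Complex.I) := by
  obtain ⟨hi, h⟩ := integral_vertical_eq_of_exp_decay hc Real.pi_pos.le hd hK
  rw [hankelIntegral, h,
    ← intervalIntegral.integral_Iic_add_Ioi (hi Real.pi (by simp [abs_of_pos Real.pi_pos])) h1,
    ← intervalIntegral.integral_Iic_add_Ioi (hi (-Real.pi) (by simp [abs_of_pos Real.pi_pos])) h2]
  ring

section Kernel

open Complex

/-- The integrand of Hankel's formula for `1 / Γ(s)` in the logarithmic coordinate. -/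
noncomputable def hankelKernel (s : ℝ) (w : ℂ) : ℂ :=
  cexp (cexp w) * cexp ((1 - s : ℝ) * w)

theorem exp_neg_pi_mul_I : cexp (((-Real.pi : ℝ) : ℂ) * I) = -1 := by
  rw [ofReal_neg, neg_mul, exp_neg, exp_pi_mul_I]
  norm_num

theorem exp_exp_add_mul_I {θ : ℝ} (hθ : cexp ((θ : ℂ) * I) = -1) (u : ℝ) :
    cexp (cexp (u + (θ : ℂ) * I)) = (Real.exp (-Real.exp u) : ℝ) := by
  rw [exp_add, hθ]
  push_cast
  ring_nf

theorem hankelKernel_add_mul_I {θ : ℝ} (hθ : cexp ((θ : ℂ) * I) = -1) (s u : ℝ) :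
    hankelKernel s (u + (θ : ℂ) * I) =
      cexp ((1 - s : ℝ) * θ * I) * (Real.exp (-Real.exp u) * Real.exp ((1 - s) * u) : ℝ) := by
  rw [hankelKernel, exp_exp_add_mul_I hθ, mul_add, exp_add, ofReal_mul]
  rw [show ((1 - s : ℝ) : ℂ) * u = (((1 - s) * u : ℝ) : ℂ) by push_cast; ring, ← ofReal_exp]
  ring_nf

theorem integrableOn_hankelKernel {θ : ℝ} (hθ : cexp ((θ : ℂ) * I) = -1) (s a : ℝ) :
    IntegrableOn (fun u : ℝ => hankelKernel s (u + (θ : ℂ) * I)) (Ioi a) := by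
  simp only [hankelKernel_add_mul_I hθ]
  exact (integrableOn_Ioi_exp_neg_exp_mul_exp a (1 - s)).ofReal.const_mul _

theorem differentiable_hankelKernel (s : ℝ) : Differentiable ℂ (hankelKernel s) := by
  unfold hankelKernel
  fun_prop

theorem norm_exp_exp_le {w : ℂ} {a : ℝ} (h : w.re ≤ a) :
    ‖cexp (cexp w)‖ ≤ Real.exp (Real.exp a) := by
  rw [norm_exp]
  refine Real.exp_le_exp.2 ((re_le_norm _).trans ?_)
  rw [norm_exp]
  exact Real.exp_le_exp.2 h

/-- For `s < 1` the factor `exp ((1 - s) w)` decays to the left, so the contour collapses. The two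
sides differ by the phase factor `2i sin(πs)`, and the reflection formula turns `Γ(1 - s) sin(πs)`
into `π / Γ(s)`. -/
theorem hankelIntegral_hankelKernel_of_lt_one {s : ℝ} (h0 : 0 < s) (h1 : s < 1) (a : ℝ) :
    hankelIntegral a (hankelKernel s) = 2 * Real.pi * I / (Real.Gamma s : ℝ) := by
  have h := hankelIntegral_eq_of_exp_decay (F := hankelKernel s) (a := a)
    (c := 1 - s) (K := Real.exp (Real.exp a)) (by linarith)
    (fun w _ => (differentiable_hankelKernel s) w)
    (fun w _ hw => by
      rw [hankelKernel, norm_mul, norm_exp (_ * _), re_ofReal_mul]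
      gcongr
      exact norm_exp_exp_le hw)
    (integrableOn_hankelKernel exp_pi_mul_I s a) (integrableOn_hankelKernel exp_neg_pi_mul_I s a)
  rw [h]
  simp only [hankelKernel_add_mul_I exp_pi_mul_I, hankelKernel_add_mul_I exp_neg_pi_mul_I]
  rw [integral_const_mul, integral_const_mul, integral_complex_ofReal,
    integral_exp_neg_exp_mul_exp (by linarith : 0 < 1 - s)]
  have hsin : cexp ((1 - s : ℝ) * Real.pi * I) - cexp ((1 - s : ℝ) * (-Real.pi : ℝ) * I) =
      2 * I * (Real.sin (Real.pi * s) : ℝ) := by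
    have e1 : Real.sin (Real.pi * s) = Real.sin ((1 - s) * Real.pi) := by
      rw [← Real.sin_pi_sub]; ring_nf
    rw [e1, ← ofReal_mul, ← ofReal_mul, mul_neg, exp_mul_I, exp_mul_I, ← ofReal_cos, ← ofReal_sin,
      ← ofReal_cos, ← ofReal_sin, Real.cos_neg, Real.sin_neg]
    push_cast
    ring
  have hrefl := Real.Gamma_mul_Gamma_one_sub s
  have hG := Real.Gamma_pos_of_pos h0
  have hsinpos : 0 < Real.sin (Real.pi * s) :=
    Real.sin_pos_of_pos_of_lt_pi (by positivity) (by nlinarith [Real.pi_pos])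
  have hG1 : Real.Gamma (1 - s) * Real.sin (Real.pi * s) = Real.pi / Real.Gamma s := by
    rw [eq_div_iff hsinpos.ne'] at hrefl
    rw [eq_div_iff hG.ne']
    linear_combination hrefl
  rw [← sub_mul, hsin]
  calc _ = 2 * I * ((Real.Gamma (1 - s) * Real.sin (Real.pi * s) : ℝ) : ℂ) := by push_cast; ring
    _ = _ := by rw [hG1]; push_cast; ring

/-- Without decay at `s = 1` the contour cannot be collapsed. Here the kernel has period `2πi`, so
the two rays cancel, and the arc is the mean value of `exp` on a circle about `0`. -/
theorem hankelIntegral_hankelKernel_one (a : ℝ) :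
    hankelIntegral a (hankelKernel 1) = 2 * Real.pi * I := by
  have hmean : ∫ y in (-Real.pi)..Real.pi, hankelKernel 1 (a + y * I) = 2 * Real.pi := by
    have hav := (differentiable_exp.diffContOnCl (s := Metric.ball 0 |Real.exp a|)).circleAverage
    rw [Real.circleAverage_def, exp_zero] at hav
    have hper : Function.Periodic (fun y : ℝ => cexp (circleMap 0 (Real.exp a) y))
        (2 * Real.pi) := fun y => by
      simp only [periodic_circleMap 0 (Real.exp a) y]
    have hshift := hper.intervalIntegral_add_eq 0 (-Real.pi)
    rw [zero_add, show -Real.pi + 2 * Real.pi = Real.pi by ring] at hshift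
    rw [hshift, real_smul] at hav
    have hfun : ∀ y : ℝ, hankelKernel 1 (a + y * I) = cexp (circleMap 0 (Real.exp a) y) := by
      intro y
      rw [hankelKernel, circleMap, exp_add, ofReal_exp]
      simp
    simp only [hfun]
    have hpi : (Real.pi : ℂ) ≠ 0 := ofReal_ne_zero.2 Real.pi_ne_zero
    push_cast at hav
    field_simp at hav
    linear_combination hav
  rw [hankelIntegral, hmean]
  simp only [hankelKernel_add_mul_I exp_pi_mul_I, hankelKernel_add_mul_I exp_neg_pi_mul_I]
  simp
  ring

theorem hasDerivAt_exp_exp_mul_exp (s : ℝ) (w : ℂ) :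
    HasDerivAt (hankelKernel (s + 1)) (hankelKernel s w - s * hankelKernel (s + 1) w) w := by
  have h1 : HasDerivAt (fun w => cexp (cexp w)) (cexp (cexp w) * cexp w) w :=
    (hasDerivAt_exp w).cexp
  have h2 : HasDerivAt (fun w => cexp ((1 - (s + 1) : ℝ) * w))
      (cexp ((1 - (s + 1) : ℝ) * w) * ((1 - (s + 1) : ℝ) * 1)) w :=
    ((hasDerivAt_id w).const_mul _).cexp
  refine (h1.mul h2).congr_deriv ?_
  have h3 : cexp ((1 - s : ℝ) * w) = cexp w * cexp ((1 - (s + 1) : ℝ) * w) := by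
    rw [← exp_add]; push_cast; ring_nf
  rw [hankelKernel, hankelKernel, h3]
  push_cast
  ring

theorem tendsto_hankelKernel {θ : ℝ} (hθ : cexp ((θ : ℂ) * I) = -1) {s : ℝ} (hs : 1 < s) :
    Tendsto (fun u : ℝ => hankelKernel s (u + (θ : ℂ) * I)) atTop (𝓝 0) := by
  simp only [hankelKernel_add_mul_I hθ]
  have h1 : Tendsto (fun u : ℝ => Real.exp (-Real.exp u)) atTop (𝓝 0) :=
    Real.tendsto_exp_neg_atTop_nhds_zero.comp Real.tendsto_exp_atTop
  have h2 : Tendsto (fun u : ℝ => Real.exp ((1 - s) * u)) atTop (𝓝 0) :=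
    Real.tendsto_exp_atBot.comp (tendsto_id.const_mul_atTop_of_neg (by linarith))
  have h3 := (continuous_ofReal.tendsto 0).comp (by simpa using h1.mul h2)
  simpa using h3.const_mul (cexp ((1 - s : ℝ) * θ * I))

/-- Integration by parts: the difference of the two integrands is the derivative of `hankelKernel (s
+ 1)`, whose boundary values cancel at the corners and vanish at the ends of the rays. -/
theorem hankelIntegral_hankelKernel_rec {s : ℝ} (hs : 0 < s) (a : ℝ) :
    hankelIntegral a (hankelKernel s) = s * hankelIntegral a (hankelKernel (s + 1)) := by
  have hray : ∀ θ : ℝ, cexp ((θ : ℂ) * I) = -1 →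
      (∫ u in Ioi a, hankelKernel s (u + (θ : ℂ) * I)) -
        s * (∫ u in Ioi a, hankelKernel (s + 1) (u + (θ : ℂ) * I)) =
        -hankelKernel (s + 1) (a + (θ : ℂ) * I) := by
    intro θ hθ
    have hi := integrableOn_hankelKernel hθ s a
    have hi' := (integrableOn_hankelKernel hθ (s + 1) a).const_mul (s : ℂ)
    rw [← integral_const_mul, ← integral_sub hi hi', ← zero_sub]
    refine integral_Ioi_of_hasDerivAt_of_tendsto' (fun u _ => ?_) (hi.sub hi')
      (tendsto_hankelKernel hθ (by linarith))
    have h1 : HasDerivAt (fun z : ℂ => z + (θ : ℂ) * I) 1 (u : ℂ) := (hasDerivAt_id _).add_const _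
    have h2 := (hasDerivAt_exp_exp_mul_exp s (u + (θ : ℂ) * I)).comp (u : ℂ) h1
    rw [mul_one] at h2
    exact h2.comp_ofReal
  have hvert : I * (∫ y in (-Real.pi)..Real.pi, hankelKernel s (a + y * I)) -
      s * (I * ∫ y in (-Real.pi)..Real.pi, hankelKernel (s + 1) (a + y * I)) =
      hankelKernel (s + 1) (a + (Real.pi : ℂ) * I) -
        hankelKernel (s + 1) (a + ((-Real.pi : ℝ) : ℂ) * I) := by
    have hc : ∀ r : ℝ, Continuous fun y : ℝ => hankelKernel r (a + y * I) := fun r =>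
      (differentiable_hankelKernel r).continuous.comp (by fun_prop)
    have hd : ∀ y ∈ uIcc (-Real.pi) Real.pi, HasDerivAt
        (fun y : ℝ => hankelKernel (s + 1) (a + y * I))
        (I * hankelKernel s (a + y * I) - s * (I * hankelKernel (s + 1) (a + y * I))) y := by
      intro y _
      have h1 : HasDerivAt (fun z : ℂ => (a : ℂ) + z * I) (1 * I) (y : ℂ) :=
        ((hasDerivAt_id _).mul_const I).const_add _
      have h2 := (hasDerivAt_exp_exp_mul_exp s (a + y * I)).comp (y : ℂ) h1
      refine h2.comp_ofReal.congr_deriv ?_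
      ring
    rw [← intervalIntegral.integral_const_mul, ← intervalIntegral.integral_const_mul,
      ← intervalIntegral.integral_const_mul, ← intervalIntegral.integral_sub]
    · exact intervalIntegral.integral_eq_sub_of_hasDerivAt hd
        (Continuous.intervalIntegrable (by have := hc s; have := hc (s + 1); fun_prop) _ _)
    · exact ((hc s).const_mul I).intervalIntegrable _ _
    · exact (((hc (s + 1)).const_mul I).const_mul _).intervalIntegrable _ _
  have h1 := hray Real.pi exp_pi_mul_I
  have h2 := hray (-Real.pi) exp_neg_pi_mul_I
  rw [hankelIntegral, hankelIntegral]
  linear_combination hvert + h1 - h2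

/-- Hankel's formula for the reciprocal Gamma function at positive arguments. -/
theorem hankelIntegral_hankelKernel {s : ℝ} (hs : 0 < s) (a : ℝ) :
    hankelIntegral a (hankelKernel s) = 2 * Real.pi * I / (Real.Gamma s : ℝ) := by
  have key : ∀ n : ℕ, ∀ s : ℝ, 0 < s → s ≤ n + 1 →
      hankelIntegral a (hankelKernel s) = 2 * Real.pi * I / (Real.Gamma s : ℝ) := by
    intro n
    induction n with
    | zero =>
      intro s h0 h1
      rcases h1.lt_or_eq with h | h
      · exact hankelIntegral_hankelKernel_of_lt_one h0 (by simpa using h) a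
      · have : s = 1 := by simpa using h
        rw [this, hankelIntegral_hankelKernel_one, Real.Gamma_one]
        simp
    | succ n ih =>
      intro s h0 h1
      rcases le_or_gt s 1 with h | h
      · exact ih s h0 (by have : (0 : ℝ) ≤ n := n.cast_nonneg; linarith)
      · have h2 : 0 < s - 1 := by linarith
        have h3 := hankelIntegral_hankelKernel_rec h2 a
        rw [ih (s - 1) h2 (by push_cast at h1; linarith), sub_add_cancel] at h3
        have h4 := Real.Gamma_add_one h2.ne'
        rw [sub_add_cancel] at h4
        have h5 := Real.Gamma_pos_of_pos h2
        have h6 : ((s - 1 : ℝ) : ℂ) ≠ 0 := ofReal_ne_zero.2 h2.ne'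
        have h7 : ((Real.Gamma (s - 1) : ℝ) : ℂ) ≠ 0 := ofReal_ne_zero.2 h5.ne'
        rw [h4, ofReal_mul]
        field_simp at h3 ⊢
        linear_combination -h3
  obtain ⟨n, hn⟩ := exists_nat_ge s
  exact key n s hs (by linarith)

end Kernel

/-! ### The integral representation of `E_β` on the negative axis and its asymptotics -/

section Representation

open Complex

/-- The integrand of the Hankel integral of `E_β(-x)` in the logarithmic coordinate. -/
noncomputable def mittagLefflerKernel (β x : ℝ) (w : ℂ) : ℂ :=
  cexp (cexp w) * (cexp (β * w) / (x + cexp (β * w)))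

/-- For `β < 1/2` the strip `|Im w| ≤ π` is mapped into the right half-plane. Hence `|x + e^{βw}| ≥
x`: no pole obstructs the collapse of the contour, and this one bound supplies every domination
below. -/
theorem exp_mul_re_nonneg {β : ℝ} (hβ : 0 < β) (hβ1 : β < 1 / 2) {w : ℂ}
    (hw : |w.im| ≤ Real.pi) : 0 ≤ (cexp (β * w)).re := by
  rw [exp_re, re_ofReal_mul, im_ofReal_mul]
  refine mul_nonneg (Real.exp_pos _).le (Real.cos_nonneg_of_mem_Icc ?_)
  obtain ⟨h1, h2⟩ := abs_le.1 hw
  have := Real.pi_pos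
  constructor <;> nlinarith

theorem le_norm_add_of_re_nonneg {x : ℝ} {z : ℂ} (hz : 0 ≤ z.re) : x ≤ ‖(x : ℂ) + z‖ := by
  refine le_trans ?_ (re_le_norm _)
  simp [hz]

theorem add_exp_ne_zero {β x : ℝ} (hβ : 0 < β) (hβ1 : β < 1 / 2) (hx : 0 < x) {w : ℂ}
    (hw : |w.im| ≤ Real.pi) : (x : ℂ) + cexp (β * w) ≠ 0 :=
  norm_pos_iff.1 (hx.trans_le (le_norm_add_of_re_nonneg (exp_mul_re_nonneg hβ hβ1 hw)))

theorem norm_mittagLefflerKernel_le {β x : ℝ} (hβ : 0 < β) (hβ1 : β < 1 / 2) (hx : 0 < x) {w : ℂ}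
    (hw : |w.im| ≤ Real.pi) :
    ‖mittagLefflerKernel β x w‖ ≤ ‖cexp (cexp w)‖ * (Real.exp (β * w.re) / x) := by
  rw [mittagLefflerKernel, norm_mul, norm_div, norm_exp (_ * _), re_ofReal_mul]
  gcongr
  exact le_norm_add_of_re_nonneg (exp_mul_re_nonneg hβ hβ1 hw)

theorem differentiableAt_mittagLefflerKernel {β x : ℝ} (hβ : 0 < β) (hβ1 : β < 1 / 2)
    (hx : 0 < x) {w : ℂ} (hw : |w.im| ≤ Real.pi) :
    DifferentiableAt ℂ (mittagLefflerKernel β x) w := by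
  have := add_exp_ne_zero hβ hβ1 hx hw
  unfold mittagLefflerKernel
  fun_prop (disch := assumption)

theorem integrable_mittagLefflerKernel {β x θ : ℝ} (hβ : 0 < β) (hβ1 : β < 1 / 2)
    (hx : 0 < x) (hθ : cexp ((θ : ℂ) * I) = -1) (hθ' : |θ| ≤ Real.pi) :
    Integrable fun u : ℝ => mittagLefflerKernel β x (u + (θ : ℂ) * I) := by
  have hcont : Continuous fun u : ℝ => mittagLefflerKernel β x (u + (θ : ℂ) * I) := by
    refine continuous_iff_continuousAt.2 fun u => ?_
    have h1 : ContinuousAt (mittagLefflerKernel β x) (u + (θ : ℂ) * I) :=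
      (differentiableAt_mittagLefflerKernel hβ hβ1 hx (by simpa using hθ')).continuousAt
    exact ContinuousAt.comp (f := fun u : ℝ => (u : ℂ) + (θ : ℂ) * I) h1
      (Continuous.continuousAt (by fun_prop))
  refine ((integrable_exp_neg_exp_mul_exp hβ).div_const x).mono' hcont.aestronglyMeasurable
    (Eventually.of_forall fun u => ?_)
  refine (norm_mittagLefflerKernel_le hβ hβ1 hx (by simpa using hθ')).trans_eq ?_
  rw [exp_exp_add_mul_I hθ, norm_real, Real.norm_of_nonneg (Real.exp_pos _).le]
  simp
  ring

theorem hasSum_hankelKernel {β x : ℝ} {w : ℂ} (h : |x| < Real.exp (β * w.re)) :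
    HasSum (fun k : ℕ => (-(x : ℂ)) ^ k * hankelKernel (k * β + 1) w)
      (mittagLefflerKernel β x w) := by
  set q := cexp (β * w) with hq
  have hq0 : q ≠ 0 := exp_ne_zero _
  have hnq : ‖q‖ = Real.exp (β * w.re) := by rw [hq, norm_exp, re_ofReal_mul]
  have hlt : ‖-(x : ℂ) / q‖ < 1 := by
    rw [norm_div, norm_neg, norm_real, hnq, Real.norm_eq_abs, div_lt_one (Real.exp_pos _)]
    exact h
  have hs := (hasSum_geometric_of_norm_lt_one hlt).mul_left (cexp (cexp w))
  have hval : cexp (cexp w) * (1 - -(x : ℂ) / q)⁻¹ = mittagLefflerKernel β x w := by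
    rw [mittagLefflerKernel, ← hq, sub_eq_add_neg, ← neg_div, neg_neg,
      show 1 + (x : ℂ) / q = (x + q) / q by field_simp; ring, inv_div]
  rw [hval] at hs
  refine hs.congr_fun fun k => ?_
  rw [hankelKernel, div_pow, hq, ← exp_nat_mul]
  rw [show ((1 - (k * β + 1) : ℝ) : ℂ) * w = -(k * (β * w)) by push_cast; ring, exp_neg]
  ring

/-- Termwise integration of the geometric series of the Hankel integrand. -/
theorem hasSum_integral_hankelKernel {β x a : ℝ} (hβ : 0 < β) (hx : 0 ≤ x)
    (ha : 2 * x < Real.exp (β * a)) {ν : Measure ℝ} {p : ℝ → ℂ} (hp : Continuous p)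
    (hre : ∀ᵐ u ∂ν, a ≤ (p u).re) (hi : Integrable (fun u => cexp (cexp (p u))) ν) :
    HasSum (fun k : ℕ => (-(x : ℂ)) ^ k * ∫ u, hankelKernel (k * β + 1) (p u) ∂ν)
      (∫ u, mittagLefflerKernel β x (p u) ∂ν) := by
  simp only [← integral_const_mul]
  have hre' : ∀ᵐ u ∂ν, 2 * x < Real.exp (β * (p u).re) := by
    filter_upwards [hre] with u hu
    exact ha.trans_le (Real.exp_le_exp.2 (by gcongr))
  -- The hypothesis `2x < exp (β a)` keeps the ratio `x e^{-βw}` of the geometric series below `1/2`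
  -- in norm along the whole contour.
  refine hasSum_integral_of_dominated_convergence
    (fun k u => ‖cexp (cexp (p u))‖ * (1 / 2) ^ k) (fun k => ?_) (fun k => ?_) ?_ ?_ ?_
  · exact (((differentiable_hankelKernel _).continuous.comp hp).const_mul
      _).aestronglyMeasurable
  · filter_upwards [hre'] with u hu
    rw [hankelKernel, norm_mul, norm_mul, norm_pow, norm_neg, norm_real, norm_exp (_ * _),
      re_ofReal_mul, Real.norm_of_nonneg hx, mul_left_comm]
    gcongr
    rw [show (1 - (k * β + 1)) * (p u).re = -(k * (β * (p u).re)) by ring, Real.exp_neg,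
      Real.exp_nat_mul, ← inv_pow, ← mul_pow]
    refine pow_le_pow_left₀ (by positivity) ?_ k
    rw [← div_eq_mul_inv, div_le_div_iff₀ (Real.exp_pos _) two_pos]
    linarith
  · exact Eventually.of_forall fun u => summable_geometric_two.mul_left _
  · simp only [tsum_mul_left]
    exact hi.norm.mul_const _
  · filter_upwards [hre'] with u hu
    refine hasSum_hankelKernel ?_
    rw [abs_of_nonneg hx]
    linarith

/-- Hankel's integral for the Mittag-Leffler function. -/
theorem hankelIntegral_mittagLefflerKernel {β x a : ℝ} (hβ : 0 < β) (hx : 0 ≤ x)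
    (ha : 2 * x < Real.exp (β * a)) :
    hankelIntegral a (mittagLefflerKernel β x) =
      2 * Real.pi * I * (mittagLeffler β (-x) : ℝ) := by
  have hray : ∀ θ : ℝ, cexp ((θ : ℂ) * I) = -1 → HasSum
      (fun k : ℕ => (-(x : ℂ)) ^ k * ∫ u in Ioi a, hankelKernel (k * β + 1) (u + (θ : ℂ) * I))
      (∫ u in Ioi a, mittagLefflerKernel β x (u + (θ : ℂ) * I)) := by
    intro θ hθ
    refine hasSum_integral_hankelKernel hβ hx ha (p := fun u : ℝ => (u : ℂ) + (θ : ℂ) * I)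
      (by fun_prop) ?_ ?_
    · filter_upwards [ae_restrict_mem measurableSet_Ioi] with u hu
      simpa using le_of_lt hu
    -- At `s = 1` the factor `exp ((1 - s) w)` is `1`, which leaves `exp (exp w)`.
    · have := integrableOn_hankelKernel hθ 1 a
      refine this.congr (Eventually.of_forall fun u => ?_)
      simp [hankelKernel]
  have hvert := hasSum_integral_hankelKernel hβ hx ha
    (ν := volume.restrict (Ioc (-Real.pi) Real.pi)) (p := fun y : ℝ => (a : ℂ) + y * I)
    (by fun_prop) (Eventually.of_forall fun u => by simp)
    (Continuous.integrableOn_Ioc (by fun_prop))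
  have hpi : -Real.pi ≤ Real.pi := by linarith [Real.pi_pos]
  have h1 := (hvert.mul_left I).add
    ((hray _ exp_pi_mul_I).sub (hray _ exp_neg_pi_mul_I))
  have h2 : HasSum (fun k : ℕ => (-(x : ℂ)) ^ k * hankelIntegral a (hankelKernel (k * β + 1)))
      (hankelIntegral a (mittagLefflerKernel β x)) := by
    rw [hankelIntegral, intervalIntegral.integral_of_le hpi]
    refine h1.congr_fun fun k => ?_
    rw [hankelIntegral, intervalIntegral.integral_of_le hpi]
    ring
  have h3 := (hasSum_ofReal.2 (hasSum_mittagLefflerTwo hβ one_pos (-x))).mul_left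
    (2 * Real.pi * I)
  refine h2.unique (h3.congr_fun fun k => ?_)
  rw [hankelIntegral_hankelKernel (by positivity)]
  push_cast
  ring

/-- The kernel commutes with conjugation, so the difference of the two rays is `2i` times an
imaginary part. -/
theorem integral_conj_mittagLefflerKernel (β x : ℝ) :
    ∫ u : ℝ, mittagLefflerKernel β x (u + ((-Real.pi : ℝ) : ℂ) * I) =
      (starRingEnd ℂ) (∫ u : ℝ, mittagLefflerKernel β x (u + (Real.pi : ℂ) * I)) := by
  rw [← integral_conj]
  congr 1
  ext u
  have h : (u : ℂ) + ((-Real.pi : ℝ) : ℂ) * I = (starRingEnd ℂ) (u + (Real.pi : ℂ) * I) := by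
    simp
  rw [h, mittagLefflerKernel, mittagLefflerKernel]
  simp only [map_mul, map_div₀, map_add, ← exp_conj, conj_ofReal]

theorem mittagLeffler_neg_eq_integral {β x : ℝ} (hβ : 0 < β) (hβ1 : β < 1 / 2) (hx : 0 < x) :
    mittagLeffler β (-x) = 1 / Real.pi *
      (∫ u : ℝ, mittagLefflerKernel β x (u + (Real.pi : ℂ) * I)).im := by
  -- Any `a` far enough right for the series to converge will do; it disappears when the contour is
  -- collapsed.
  obtain ⟨a, ha⟩ : ∃ a : ℝ, 2 * x < Real.exp (β * a) := by
    have h : Tendsto (fun a : ℝ => Real.exp (β * a)) atTop atTop :=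
      Real.tendsto_exp_atTop.comp (tendsto_id.const_mul_atTop hβ)
    exact (h.eventually_gt_atTop (2 * x)).exists
  have h1 := hankelIntegral_mittagLefflerKernel hβ hx.le ha
  have hpi : |Real.pi| ≤ Real.pi := (abs_of_pos Real.pi_pos).le
  have hpi' : |-Real.pi| ≤ Real.pi := by rwa [abs_neg]
  rw [hankelIntegral_eq_of_exp_decay (c := β) (K := Real.exp (Real.exp a) / x) hβ
    (fun w hw => differentiableAt_mittagLefflerKernel hβ hβ1 hx hw)
    (fun w hw hw' => by
      refine (norm_mittagLefflerKernel_le hβ hβ1 hx hw).trans ?_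
      rw [div_mul_eq_mul_div, ← mul_div_assoc]
      gcongr
      exact norm_exp_exp_le hw')
    (integrable_mittagLefflerKernel hβ hβ1 hx exp_pi_mul_I hpi).integrableOn
    (integrable_mittagLefflerKernel hβ hβ1 hx exp_neg_pi_mul_I hpi').integrableOn,
    integral_conj_mittagLefflerKernel, sub_conj] at h1
  have h2 : ((∫ u : ℝ, mittagLefflerKernel β x (u + (Real.pi : ℂ) * I)).im : ℂ) =
      ((Real.pi * mittagLeffler β (-x) : ℝ) : ℂ) := by
    have hI : (2 * I : ℂ) ≠ 0 := by simp
    apply mul_left_cancel₀ hI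
    push_cast at h1 ⊢
    linear_combination h1
  have h3 := ofReal_injective h2
  rw [h3]
  have := Real.pi_pos
  field_simp

end Representation

/-! ### Asymptotics of `E_β` and its derivative at `-∞` -/

section Asymptotics

open Complex

theorem exp_exp_mul_exp_add_pi (β u : ℝ) :
    cexp (cexp (u + (Real.pi : ℂ) * I)) * cexp (β * (u + (Real.pi : ℂ) * I)) =
      cexp ((β * Real.pi : ℝ) * I) * (Real.exp (-Real.exp u) * Real.exp (β * u) : ℝ) := by
  rw [exp_exp_add_mul_I exp_pi_mul_I, mul_add, exp_add]
  push_cast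
  ring_nf

theorem integrable_exp_exp_mul_exp_add_pi {β : ℝ} (hβ : 0 < β) :
    Integrable fun u : ℝ => cexp (cexp (u + (Real.pi : ℂ) * I)) *
      cexp (β * (u + (Real.pi : ℂ) * I)) := by
  simp only [exp_exp_mul_exp_add_pi]
  exact (integrable_exp_neg_exp_mul_exp hβ).ofReal.const_mul _

theorem integral_exp_exp_mul_exp_add_pi_im {β : ℝ} (hβ : 0 < β) :
    (∫ u : ℝ, cexp (cexp (u + (Real.pi : ℂ) * I)) * cexp (β * (u + (Real.pi : ℂ) * I))).im =
      Real.Gamma β * Real.sin (β * Real.pi) := by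
  simp only [exp_exp_mul_exp_add_pi]
  rw [integral_const_mul, integral_complex_ofReal, integral_exp_neg_exp_mul_exp hβ, im_mul_ofReal,
    exp_ofReal_mul_I_im, mul_comm]

theorem tendsto_ofReal_div_add (z : ℂ) :
    Tendsto (fun x : ℝ => (x : ℂ) / (x + z)) atTop (𝓝 1) := by
  have h1 : Tendsto (fun x : ℝ => (x : ℂ)⁻¹) atTop (𝓝 0) := by
    have := (continuous_ofReal.tendsto 0).comp (tendsto_inv_atTop_zero (𝕜 := ℝ))
    simpa [Function.comp_def] using this
  have h2 := ((h1.const_mul z).const_add 1).inv₀ (by simp)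
  simp only [mul_zero, add_zero, inv_one] at h2
  refine h2.congr' ?_
  filter_upwards [eventually_gt_atTop 0] with x hx
  have hx' : (x : ℂ) ≠ 0 := ofReal_ne_zero.2 hx.ne'
  rw [show 1 + z * (x : ℂ)⁻¹ = (x + z) / x by field_simp, inv_div]

theorem norm_ofReal_div_add_le_one {x : ℝ} (hx : 0 < x) {z : ℂ} (hz : 0 ≤ z.re) :
    ‖(x : ℂ) / (x + z)‖ ≤ 1 := by
  have h := le_norm_add_of_re_nonneg (x := x) hz
  rw [norm_div, norm_real, Real.norm_of_nonneg hx.le, div_le_one (hx.trans_le h)]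
  exact h

/-- Dominated by `|k|`, since `Re Q ≥ 0` gives `|x/(x + Q)| ≤ 1`. The case `n = 1` serves `E_β`, the
case `n = 2` its derivative. -/
theorem tendsto_integral_mul_pow_div_add {k Q : ℝ → ℂ} (hk : Integrable k) (hQ : Continuous Q)
    (hre : ∀ u, 0 ≤ (Q u).re) (n : ℕ) :
    Tendsto (fun x : ℝ => ∫ u, k u * ((x : ℂ) / (x + Q u)) ^ n) atTop (𝓝 (∫ u, k u)) := by
  refine tendsto_integral_filter_of_dominated_convergence (fun u => ‖k u‖)
    (Eventually.of_forall fun x => ?_) ?_ hk.norm (Eventually.of_forall fun u => ?_)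
  · refine hk.aestronglyMeasurable.mul (Measurable.aestronglyMeasurable ?_)
    have := hQ.measurable
    fun_prop
  · filter_upwards [eventually_gt_atTop 0] with x hx
    refine Eventually.of_forall fun u => ?_
    rw [norm_mul, norm_pow]
    exact mul_le_of_le_one_right (norm_nonneg _)
      (pow_le_one₀ (norm_nonneg _) (norm_ofReal_div_add_le_one hx (hre u)))
  · simpa using ((tendsto_ofReal_div_add (Q u)).pow n).const_mul (k u)

theorem hasDerivAt_integral_div_add {k Q : ℝ → ℂ} (hk : Integrable k) (hQ : Continuous Q)
    (hre : ∀ u, 0 ≤ (Q u).re) {x : ℝ} (hx : 0 < x) :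
    HasDerivAt (fun x : ℝ => ∫ u, k u / (x + Q u)) (∫ u, -(k u / (x + Q u) ^ 2)) x := by
  -- On the neighbourhood `y > x/2` of `x` the denominator stays at least `x/2`, which gives a
  -- dominating function independent of `y`.
  have hx2 : 0 < x / 2 := by positivity
  have hne : ∀ y : ℝ, x / 2 < y → ∀ u, x / 2 ≤ ‖(y : ℂ) + Q u‖ := fun y hy u =>
    hy.le.trans (le_norm_add_of_re_nonneg (hre u))
  have hmeas : ∀ (y : ℝ) (n : ℕ), AEStronglyMeasurable (fun u => k u / (y + Q u) ^ n) := by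
    intro y n
    simp only [div_eq_mul_inv]
    refine hk.aestronglyMeasurable.mul (Measurable.aestronglyMeasurable ?_)
    have := hQ.measurable
    fun_prop
  refine (hasDerivAt_integral_of_dominated_loc_of_deriv_le (s := Ioi (x / 2))
    (bound := fun u => ‖k u‖ / (x / 2) ^ 2) (F' := fun y u => -(k u / ((y : ℝ) + Q u) ^ 2))
    (Ioi_mem_nhds (by linarith)) ?_ ?_ ?_ ?_ ?_ ?_).2
  · exact Eventually.of_forall fun y => by simpa using hmeas y 1
  · refine (hk.norm.div_const (x / 2)).mono' (by simpa using hmeas x 1)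
      (Eventually.of_forall fun u => ?_)
    rw [norm_div]
    gcongr
    exact hne x (by linarith) u
  · exact (hmeas x 2).neg
  · refine Eventually.of_forall fun u y hy => ?_
    rw [norm_neg, norm_div, norm_pow]
    gcongr
    exact hne y hy u
  · exact hk.norm.div_const _
  · refine Eventually.of_forall fun u y hy => ?_
    have h0 : (y : ℂ) + Q u ≠ 0 := norm_pos_iff.1 (hx2.trans_le (hne y hy u))
    have h1 : HasDerivAt (fun z : ℂ => z + Q u) 1 (y : ℂ) := (hasDerivAt_id _).add_const _
    have h2 := ((h1.inv h0).const_mul (k u)).comp_ofReal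
    simp only [Pi.inv_apply, ← div_eq_mul_inv] at h2
    refine h2.congr_deriv ?_
    ring

/-- The leading coefficient `Γ(β) sin(β π) / π = 1 / Γ(1 - β)` of `E_β` at `-∞`. -/
noncomputable def mittagLefflerCoeff (β : ℝ) : ℝ :=
  1 / Real.pi * (Real.Gamma β * Real.sin (β * Real.pi))

theorem mittagLefflerCoeff_pos {β : ℝ} (hβ : 0 < β) (hβ1 : β < 1) : 0 < mittagLefflerCoeff β := by
  have h1 := Real.Gamma_pos_of_pos hβ
  have h2 := Real.sin_pos_of_pos_of_lt_pi (mul_pos hβ Real.pi_pos)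
    (by nlinarith [Real.pi_pos])
  have := Real.pi_pos
  unfold mittagLefflerCoeff
  positivity

theorem mittagLefflerKernel_eq_div (β x : ℝ) (w : ℂ) :
    mittagLefflerKernel β x w = cexp (cexp w) * cexp (β * w) / (x + cexp (β * w)) := by
  rw [mittagLefflerKernel, mul_div_assoc]

theorem exp_mul_add_pi_re_nonneg {β : ℝ} (hβ : 0 < β) (hβ1 : β < 1 / 2) (u : ℝ) :
    0 ≤ (cexp (β * (u + (Real.pi : ℂ) * I))).re :=
  exp_mul_re_nonneg hβ hβ1 (by simp [abs_of_pos Real.pi_pos])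

theorem tendsto_mul_mittagLeffler_neg {β : ℝ} (hβ : 0 < β) (hβ1 : β < 1 / 2) :
    Tendsto (fun x : ℝ => x * mittagLeffler β (-x)) atTop (𝓝 (mittagLefflerCoeff β)) := by
  have h := tendsto_integral_mul_pow_div_add (integrable_exp_exp_mul_exp_add_pi hβ)
    (Q := fun u : ℝ => cexp (β * (u + (Real.pi : ℂ) * I))) (by fun_prop)
    (exp_mul_add_pi_re_nonneg hβ hβ1) 1
  have h2 := ((continuous_im.tendsto _).comp h).const_mul (1 / Real.pi)
  rw [integral_exp_exp_mul_exp_add_pi_im hβ] at h2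
  refine h2.congr' ?_
  filter_upwards [eventually_gt_atTop 0] with x hx
  rw [mittagLeffler_neg_eq_integral hβ hβ1 hx, mul_left_comm, ← im_ofReal_mul,
    ← integral_const_mul]
  simp only [Function.comp_apply, mittagLefflerKernel_eq_div, pow_one]
  congr 3
  ext u
  ring

/-- An asymptotic relation may not be differentiated, so the integral representation is: the
derivative of `E_β(-x)` is computed from the series and from the integral, and the two are equated.
-/
theorem tendsto_sq_mul_deriv_mittagLeffler_neg {β : ℝ} (hβ : 0 < β) (hβ1 : β < 1 / 2) :
    Tendsto (fun x : ℝ => x ^ 2 * (1 / β * mittagLefflerTwo β β (-x))) atTop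
      (𝓝 (mittagLefflerCoeff β)) := by
  set k : ℝ → ℂ := fun u => cexp (cexp (u + (Real.pi : ℂ) * I)) *
    cexp (β * (u + (Real.pi : ℂ) * I)) with hk
  set Q : ℝ → ℂ := fun u => cexp (β * (u + (Real.pi : ℂ) * I)) with hQ
  have hQc : Continuous Q := by fun_prop
  have hre : ∀ u, 0 ≤ (Q u).re := exp_mul_add_pi_re_nonneg hβ hβ1
  have h := tendsto_integral_mul_pow_div_add (integrable_exp_exp_mul_exp_add_pi hβ) hQc hre 2
  have h2 := ((continuous_im.tendsto _).comp h).const_mul (1 / Real.pi)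
  rw [integral_exp_exp_mul_exp_add_pi_im hβ] at h2
  refine h2.congr' ?_
  filter_upwards [eventually_gt_atTop 0] with x hx
  have hd1 : HasDerivAt (fun x : ℝ => mittagLeffler β (-x))
      (1 / β * mittagLefflerTwo β β (-x) * -1) x :=
    (hasDerivAt_mittagLeffler hβ (-x)).comp x (hasDerivAt_neg x)
  have hd2 : HasDerivAt (fun x : ℝ => mittagLeffler β (-x))
      (1 / Real.pi * (∫ u, -(k u / (x + Q u) ^ 2)).im) x := by
    have h3 := hasDerivAt_integral_div_add (integrable_exp_exp_mul_exp_add_pi hβ) hQc hre hx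
    have h4 := (imCLM.hasFDerivAt.comp_hasDerivAt x h3).const_mul (1 / Real.pi)
    refine h4.congr_of_eventuallyEq ?_
    filter_upwards [Ioi_mem_nhds hx] with y hy
    rw [mittagLeffler_neg_eq_integral hβ hβ1 hy]
    simp only [mittagLefflerKernel_eq_div]
    rfl
  have h5 := hd1.unique hd2
  rw [integral_neg, neg_im] at h5
  have h6 : 1 / β * mittagLefflerTwo β β (-x) = 1 / Real.pi * (∫ u, k u / (x + Q u) ^ 2).im := by
    linarith
  rw [h6, mul_left_comm, ← im_ofReal_mul, ← integral_const_mul]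
  simp only [Function.comp_apply]
  congr 3
  ext u
  change k u * ((x : ℂ) / (x + Q u)) ^ 2 = ((x ^ 2 : ℝ) : ℂ) * (k u / (x + Q u) ^ 2)
  rw [div_pow, mul_div_left_comm, ofReal_pow]

end Asymptotics

/-! ### Recovery of the order from the behaviour at infinity. -/

section OrderRecovery

variable {β : ℝ}

theorem tendsto_const_mul_rpow_atTop {l : ℝ} (hβ : 0 < β) (hl : 0 < l) :
    Tendsto (fun t : ℝ => l * t ^ β) atTop atTop :=
  (tendsto_rpow_atTop hβ).const_mul_atTop hl

theorem tendsto_rpow_mul_mittagLeffler_rpow (hβ : 0 < β) (hβ1 : β < 1 / 2) {r : ℝ} (hr : r < 0) :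
    Tendsto (fun t : ℝ => t ^ β * mittagLeffler β (r * t ^ β)) atTop
      (𝓝 (mittagLefflerCoeff β * (1 / -r))) := by
  have h := ((tendsto_mul_mittagLeffler_neg hβ hβ1).comp
    (tendsto_const_mul_rpow_atTop hβ (neg_pos.2 hr))).mul_const (1 / -r)
  refine h.congr fun t => ?_
  simp only [Function.comp_apply, neg_mul, neg_neg]
  field_simp [hr.ne]

/-- With `x = -r t^β` one has `t d/dt = β x d/dx`, so the expression equals `-β x² E_β'(-x) / (-r)`.
-/
theorem tendsto_rpow_mul_deriv_mittagLeffler_rpow (hβ : 0 < β) (hβ1 : β < 1 / 2) {r : ℝ}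
    (hr : r < 0) :
    Tendsto (fun t : ℝ => t ^ β * (t * deriv (fun t : ℝ => mittagLeffler β (r * t ^ β)) t)) atTop
      (𝓝 (-β * (mittagLefflerCoeff β * (1 / -r)))) := by
  have h := (((tendsto_sq_mul_deriv_mittagLeffler_neg hβ hβ1).comp
    (tendsto_const_mul_rpow_atTop hβ (neg_pos.2 hr))).mul_const (1 / -r)).const_mul (-β)
  refine h.congr' ?_
  filter_upwards [eventually_gt_atTop 0] with t ht
  rw [deriv_mittagLeffler_rpow hβ r ht, Real.rpow_sub_one ht.ne']
  simp only [Function.comp_apply, neg_mul, neg_neg]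
  have := hr.ne
  field_simp

/-- The decay order of a combination of Mittag-Leffler functions with nonzero leading term. -/
theorem mittagLeffler_combination_asymptotics (hβ : 0 < β) (hβ1 : β < 1 / 2)
    {a₁ a₂ r₁ r₂ : ℝ} (hr₁ : r₁ < 0) (hr₂ : r₂ < 0) (h : a₁ / r₁ + a₂ / r₂ ≠ 0) {u : ℝ → ℝ}
    (hu : ∀ t, 0 < t → u t = a₁ * mittagLeffler β (r₁ * t ^ β) +
      a₂ * mittagLeffler β (r₂ * t ^ β)) :
    (∀ᶠ t in atTop, u t ≠ 0) ∧
      Tendsto (fun t : ℝ => t * deriv u t / u t) atTop (𝓝 (-β)) := by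
  set S := a₁ * (mittagLefflerCoeff β * (1 / -r₁)) + a₂ * (mittagLefflerCoeff β * (1 / -r₂))
    with hS
  have hS0 : S ≠ 0 := by
    have : S = -mittagLefflerCoeff β * (a₁ / r₁ + a₂ / r₂) := by
      rw [hS]
      have := hr₁.ne
      have := hr₂.ne
      field_simp
      ring
    rw [this]
    exact mul_ne_zero (neg_ne_zero.2 (mittagLefflerCoeff_pos hβ (by linarith)).ne') h
  have h1 : Tendsto (fun t => t ^ β * u t) atTop (𝓝 S) := by
    refine (((tendsto_rpow_mul_mittagLeffler_rpow hβ hβ1 hr₁).const_mul a₁).add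
      ((tendsto_rpow_mul_mittagLeffler_rpow hβ hβ1 hr₂).const_mul a₂)).congr' ?_
    filter_upwards [eventually_gt_atTop 0] with t ht
    rw [hu t ht]
    ring
  have h2 : Tendsto (fun t => t ^ β * (t * deriv u t)) atTop (𝓝 (-β * S)) := by
    have h3 := ((tendsto_rpow_mul_deriv_mittagLeffler_rpow hβ hβ1 hr₁).const_mul a₁).add
      ((tendsto_rpow_mul_deriv_mittagLeffler_rpow hβ hβ1 hr₂).const_mul a₂)
    rw [show -β * S = a₁ * (-β * (mittagLefflerCoeff β * (1 / -r₁))) +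
      a₂ * (-β * (mittagLefflerCoeff β * (1 / -r₂))) by rw [hS]; ring]
    refine h3.congr' ?_
    filter_upwards [eventually_gt_atTop 0] with t ht
    have hd := deriv_eqOn_Ioi hu t ht
    have hd' : HasDerivAt (fun t => a₁ * mittagLeffler β (r₁ * t ^ β) +
        a₂ * mittagLeffler β (r₂ * t ^ β)) _ t :=
      ((hasDerivAt_mittagLeffler_rpow hβ r₁ ht).const_mul a₁).add
        ((hasDerivAt_mittagLeffler_rpow hβ r₂ ht).const_mul a₂)
    rw [hd, hd'.deriv, deriv_mittagLeffler_rpow hβ r₁ ht, deriv_mittagLeffler_rpow hβ r₂ ht]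
    ring
  have hne := h1.eventually_ne hS0
  refine ⟨hne.mono fun t ht => right_ne_zero_of_mul ht, ?_⟩
  -- Both the factor `t^β` and the constant `S` drop out of the quotient, which leaves `-β`.
  have h3 := h2.div h1 hS0
  rw [mul_div_cancel_right₀ _ hS0] at h3
  refine h3.congr' ?_
  filter_upwards [eventually_gt_atTop 0] with t ht
  exact mul_div_mul_left _ _ (Real.rpow_pos_of_pos ht β).ne'

end OrderRecovery

/-! ### The main theorem. -/

theorem theorem2 (β μ γ r₁ r₂ c₁ c₂ : ℝ) (hβ : 0 < β) (hβ' : β < 1 / 2) (hμ : 0 < μ)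
    (hγ : 0 < γ) (hγμ : γ < μ ^ 2)
    (hr₁ : r₁ = -μ + √(μ ^ 2 - γ)) (hr₂ : r₂ = -μ - √(μ ^ 2 - γ))
    (hc₁ : c₁ = 1 / 2 * (1 + μ / √(μ ^ 2 - γ))) (hc₂ : c₂ = 1 / 2 * (1 - μ / √(μ ^ 2 - γ))) :
    r₁ < 0 ∧ r₂ < 0 ∧
    -- both problems have exactly one solution on `[0, ∞)`, the explicit one
    (∀ u : ℝ → ℝ, IsCaputoSolution β μ γ u ↔
      ∀ t : ℝ, 0 ≤ t →
        u t = c₁ * mittagLeffler β (r₁ * t ^ β) + c₂ * mittagLeffler β (r₂ * t ^ β)) ∧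
    (∀ u : ℝ → ℝ, IsSequentialSolution β μ γ 0 u ↔
      ∀ t : ℝ, 0 ≤ t →
        u t = c₁ * mittagLeffler β (r₁ * t ^ β) + c₂ * mittagLeffler β (r₂ * t ^ β)) ∧
    -- the order is recovered from the behaviour at infinity of the solution of either problem
    (∀ u : ℝ → ℝ, IsCaputoSolution β μ γ u ∨ IsSequentialSolution β μ γ 0 u →
      (∀ᶠ t in atTop, u t ≠ 0) ∧
      Tendsto (fun t : ℝ => t * deriv u t / u t) atTop (𝓝 (-β))) ∧
    -- the role of the condition `𝒟^β u(0) = 0`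
    (∀ u : ℝ → ℝ, IsSequentialSolution β μ γ 0 u →
      ∀ t : ℝ, 0 < t → seqCaputoDeriv β 2 u t = caputoDeriv (2 * β) u t) ∧
    (∀ b a₁ a₂ : ℝ,
      IsSequentialSolution β μ γ b (fun t => a₁ * mittagLeffler β (r₁ * t ^ β) +
        a₂ * mittagLeffler β (r₂ * t ^ β)) → a₁ * r₁ + a₂ * r₂ = b) := by
  have hβ1 : β < 1 := by linarith
  set s := √(μ ^ 2 - γ) with hs
  have hs0 : 0 < s := Real.sqrt_pos.2 (by linarith)
  have hs2 : s ^ 2 = μ ^ 2 - γ := Real.sq_sqrt (by linarith)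
  have hsμ : s < μ := by nlinarith
  have hr₁n : r₁ < 0 := by linarith
  have hr₂n : r₂ < 0 := by linarith
  have q₁ : r₁ ^ 2 + 2 * μ * r₁ + γ = 0 := by rw [hr₁]; linear_combination hs2
  have q₂ : r₂ ^ 2 + 2 * μ * r₂ + γ = 0 := by rw [hr₂]; linear_combination hs2
  have hc : c₁ + c₂ = 1 := by rw [hc₁, hc₂]; ring
  have hcr : c₁ * r₁ + c₂ * r₂ = 0 := by
    rw [hc₁, hc₂, hr₁, hr₂]
    field_simp
    ring
  -- The numerator is `c₁r₂ + c₂r₁ = (c₁ + c₂)(r₁ + r₂) - (c₁r₁ + c₂r₂) = -2μ`, so the leading terms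
  -- at infinity do not cancel.
  have hlead : c₁ / r₁ + c₂ / r₂ ≠ 0 := by
    have h1 : c₁ / r₁ + c₂ / r₂ = -(2 * μ) / (r₁ * r₂) := by
      rw [div_add_div _ _ hr₁n.ne hr₂n.ne]
      congr 1
      have : r₁ + r₂ = -(2 * μ) := by rw [hr₁, hr₂]; ring
      linear_combination (c₁ + c₂) * this - hcr - 2 * μ * hc
    rw [h1]
    exact div_ne_zero (by linarith) (mul_ne_zero hr₁n.ne hr₂n.ne)
  have hC := isCaputoSolution_mittagLeffler_combination hβ hβ' q₁ q₂ hcr hc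
  have hS := isSequentialSolution_mittagLeffler_combination hβ hβ' q₁ q₂ hc
  rw [hcr] at hS
  have iC : ∀ u : ℝ → ℝ, IsCaputoSolution β μ γ u ↔ ∀ t : ℝ, 0 ≤ t →
      u t = c₁ * mittagLeffler β (r₁ * t ^ β) + c₂ * mittagLeffler β (r₂ * t ^ β) := fun u =>
    ⟨fun hu t ht => hu.unique hβ hβ' hμ.le hγ.le hC ht,
      fun h => hC.congr hβ hβ' fun t ht => (h t ht).symm⟩
  have iS : ∀ u : ℝ → ℝ, IsSequentialSolution β μ γ 0 u ↔ ∀ t : ℝ, 0 ≤ t →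
      u t = c₁ * mittagLeffler β (r₁ * t ^ β) + c₂ * mittagLeffler β (r₂ * t ^ β) := fun u =>
    ⟨fun hu t ht => hu.unique hβ hβ1 hμ.le hγ.le hS ht,
      fun h => hS.congr hβ hβ' fun t ht => (h t ht).symm⟩
  refine ⟨hr₁n, hr₂n, iC, iS, fun u hu => ?_, fun u hu t ht => ?_, fun b a₁ a₂ h => ?_⟩
  · refine mittagLeffler_combination_asymptotics hβ hβ' hr₁n hr₂n hlead fun t ht => ?_
    exact hu.elim (fun h => (iC u).1 h t ht.le) fun h => (iS u).1 h t ht.le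
  · have hu' : ∀ t, 0 < t → u t = _ := fun t ht => (iS u).1 hu t ht.le
    -- Since `c₁r₁ + c₂r₂ = 0`, both derivatives reduce to the combination with coefficients `cᵢ
    -- rᵢ²`.
    rw [caputoDeriv_congr_Ioi (by linarith) (by linarith) hu' t ht,
      caputoDeriv_two_mul_mittagLeffler_combination hβ hβ' hcr ht, seqCaputoDeriv_two,
      caputoDeriv_congr_Ioi hβ hβ1 (caputoDeriv_congr_Ioi hβ hβ1 hu') t ht, ← seqCaputoDeriv_two,
      seqCaputoDeriv_two_mittagLeffler_combination hβ hβ1 _ _ _ _ ht]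
  · exact tendsto_nhds_unique
      (tendsto_seqCaputoDeriv_one_mittagLeffler_combination hβ hβ1 a₁ a₂ r₁ r₂) h.initial_deriv
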